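/- Let $X$ be a compact connected Riemann surface of genus $g\ge 2$ with canonical bundle $K$, let $D\subset X$ be a finite subset, and let $m\ge 1$. A parabolic bundle $E_*$ on $(X,D)$ is a holomorphic vector bundle $E$ on $X$ together with, for each $p\in D$, a flag $E_p=E_{p,1}\supsetneq E_{p,2}\supsetneq\dots\supsetneq E_{p,n_p}\supsetneq E_{p,n_p+1}=0$ and real weights $0\le\alpha_1(p)<\dots<\alpha_{n_p}(p)<1$. Its parabolic slope is $\mu_{\mathrm{par}}(E_*)=\frac{1}{\operatorname{rk}E}\bigl(\deg E+\sum_{p\in D}\sum_i\alpha_i(p)\dim(E_{p,i}/E_{p,i+1})\bigr)$, and a holomorphic subbundle $F\subset E$ carries the induced parabolic structure (flags $F_p\cap E_{p,i}$ without repetitions, with the largest possible weights). Let $(E_*,\varphi)$ be a symplectic parabolic bundle of rank $2m$: $E_*$ is a parabolic bundle of rank $2m$, $L_*$ is a parabolic line bundle, and $\varphi:E_*\otimes E_*\to L_*$ is an antisymmetric homomorphism of parabolic bundles such that the induced map $\tilde\varphi:E_*\to L_*\otimes E_*^\vee$ is an isomorphism of parabolic bundles. Let $\hat\varphi:E\otimes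 E\to L$ be the induced pairing of underlying bundles. Assume that $(E_*,\varphi)$ is stable, i.e. $\mu_{\mathrm{par}}(F_*)<\mu_{\mathrm{par}}(E_*)$ for every nonzero holomorphic subbundle $F\subset E$ with $\hat\varphi(F\otimes F)=0$. Let $K(D)=K\otimes\mathcal O(D)$, and let $\mathcal W_E=H^0(X,\mathrm{PEnd}_{\mathrm{Sp}}(E_*)\otimes K(D))$ be the space of symplectic parabolic Higgs fields, that is, of the holomorphic maps $\Phi:E\to E\otimes K(D)$ with $\Phi(E_{p,i})\subset E_{p,i}\otimes K(D)|_p$ for all $p\in D$ and all $i$, and $\hat\varphi(\Phi u,v)=-\hat\varphi(u,\Phi v)$. Let $$h_E:\mathcal W_E\longrightarrow\mathcal A_{\mathrm{Sp}}=\bigoplus_{i=1}^m H^0(X,K(D)^{2i}),\qquad \Phi\longmapsto(s_2,s_4,\dots,s_{2m}),$$ be the Hitchin map, where $\det(x\cdot\mathrm{Id}-\Phi)=x^{2m}+s_2x^{2m-2}+\dots+s_{2m}$. Call $(E_*,\varphi)$ very stable if $\mathcal W_E$ contains no nonzero nilpotent Higgs field. Then: 1. if $h_E$ is quasi-finite (has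 finite fibres), then $(E_*,\varphi)$ is very stable; 2. if $(E_*,\varphi)$ is very stable, then $h_E$ is a finite morphism of affine spaces. -/

import Mathlib

open scoped Manifold ContDiff Topology
open Bundle Filter

noncomputable section

namespace ParabolicHiggs

/-! ### Parabolic structures on a vector space (a fibre) -/

/-- A weighted flag on a complex vector space `V`:
`V = V₀ ⊋ V₁ ⊋ ⋯ ⊋ V_len = 0` with real weights `0 ≤ a₀ < a₁ < ⋯ < a_{len-1} < 1`,
the weight `a i` being attached to `V i`. -/
structure WeightedFlag (V : Type*) [AddCommGroup V] [Module ℂ V] where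
  /-- number of steps -/
  len : ℕ
  /-- the subspaces -/
  flag : Fin (len + 1) → Submodule ℂ V
  /-- the weights -/
  weight : Fin len → ℝ
  flag_zero : flag 0 = ⊤
  flag_last : flag (Fin.last len) = ⊥
  flag_strictAnti : StrictAnti flag
  weight_strictMono : StrictMono weight
  weight_nonneg : ∀ i, 0 ≤ weight i
  weight_lt_one : ∀ i, weight i < 1

namespace WeightedFlag

variable {V : Type*} [AddCommGroup V] [Module ℂ V]

/-- The largest member of the flag whose weight is at least `τ` (zero if there is none). -/
def fil (P : WeightedFlag V) (τ : ℝ) : Submodule ℂ V :=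
  ⨆ (i : Fin P.len) (_ : τ ≤ P.weight i), P.flag i.castSucc

/-- The sum of weights times multiplicities of the weighted flag induced on a subspace `S`:
`∑ aᵢ · dim ((S ∩ Vᵢ) / (S ∩ Vᵢ₊₁))`. Steps at which `S ∩ Vᵢ` does not change contribute zero, so
a jump is counted with the largest weight available, as in the induced parabolic structure. -/
def weightSum (P : WeightedFlag V) (S : Submodule ℂ V) : ℝ :=
  ∑ i : Fin P.len, P.weight i *
    ((Module.finrank ℂ ↥(S ⊓ P.flag i.castSucc) : ℝ) -
      (Module.finrank ℂ ↥(S ⊓ P.flag i.succ) : ℝ))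

end WeightedFlag

/-! ### Holomorphic sections, local coordinates and differentials -/

section Base

variable {X : Type*} [TopologicalSpace X] [ChartedSpace ℂ X]

/-- The local coordinate centred at `p` (it is meaningful near `p`). -/
def coordAt (p x : X) : ℂ := chartAt ℂ p x - chartAt ℂ p p

/-- The differential at `x` of the local coordinate centred at `p`. -/
def dcoordAt (p x : X) (v : TangentSpace 𝓘(ℂ) x) : ℂ :=
  mfderiv 𝓘(ℂ) 𝓘(ℂ) (coordAt p) x v

/-- The section `s` of the holomorphic vector bundle `V` (with model fibre `F`) is holomorphic at
`p`, hence in a neighbourhood of `p`. -/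
def HolAt (F : Type*) [NormedAddCommGroup F] [NormedSpace ℂ F] {V : X → Type*}
    [TopologicalSpace (TotalSpace F V)] [∀ x, TopologicalSpace (V x)] [FiberBundle F V]
    (s : ∀ x, V x) (p : X) : Prop :=
  ContMDiffAt 𝓘(ℂ) (𝓘(ℂ).prod 𝓘(ℂ, F)) ω (fun x => TotalSpace.mk' F x (s x)) p

/-- `H⁰(X, K(D)^k)`: holomorphic `k`-differentials on `X ∖ D` with poles of order at most `k` at the
points of `D`. The fibre of `K^k` at `x` is the space of homogeneous forms of degree `k` on the
tangent line at `x`. Near `p ∉ D` the differential is `ψ · (dz)^k`, near `p ∈ D` it is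
`ψ · (dz / z)^k`, with `ψ` holomorphic at `p` and `z` the coordinate centred at `p`. A section is
determined by its restriction to `X ∖ D`; the value at the points of `D` is fixed to be `0`. -/
def logDifferentials (X : Type*) [TopologicalSpace X] [ChartedSpace ℂ X] (D : Finset X) (k : ℕ) :
    Submodule ℂ (∀ x : X, TangentSpace 𝓘(ℂ) x → ℂ) where
  carrier := {q |
    (∀ p ∈ D, q p = 0) ∧
    (∀ p ∉ D, ∃ ψ : X → ℂ, ContMDiffAt 𝓘(ℂ) 𝓘(ℂ) ω ψ p ∧
      ∀ᶠ x in 𝓝 p, ∀ v, q x v = dcoordAt p x v ^ k * ψ x) ∧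
    (∀ p ∈ D, ∃ ψ : X → ℂ, ContMDiffAt 𝓘(ℂ) 𝓘(ℂ) ω ψ p ∧
      ∀ᶠ x in 𝓝[≠] p, ∀ v, coordAt p x ^ k * q x v = dcoordAt p x v ^ k * ψ x)}
  zero_mem' := by
    refine ⟨fun p _ => rfl, fun p _ => ⟨0, contMDiffAt_const, ?_⟩,
      fun p _ => ⟨0, contMDiffAt_const, ?_⟩⟩ <;> simp
  add_mem' := by
    rintro a b ⟨ha1, ha2, ha3⟩ ⟨hb1, hb2, hb3⟩
    refine ⟨fun p hp => by simp [ha1 p hp, hb1 p hp], fun p hp => ?_, fun p hp => ?_⟩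
    · obtain ⟨ψ, hψ, h⟩ := ha2 p hp
      obtain ⟨ψ', hψ', h'⟩ := hb2 p hp
      refine ⟨ψ + ψ', hψ.add hψ', ?_⟩
      filter_upwards [h, h'] with x hx hx' v
      simp only [Pi.add_apply, hx v, hx' v]; ring
    · obtain ⟨ψ, hψ, h⟩ := ha3 p hp
      obtain ⟨ψ', hψ', h'⟩ := hb3 p hp
      refine ⟨ψ + ψ', hψ.add hψ', ?_⟩
      filter_upwards [h, h'] with x hx hx' v
      simp only [Pi.add_apply, mul_add, hx v, hx' v]
  smul_mem' := by
    rintro c a ⟨ha1, ha2, ha3⟩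
    refine ⟨fun p hp => by simp [ha1 p hp], fun p hp => ?_, fun p hp => ?_⟩
    · obtain ⟨ψ, hψ, h⟩ := ha2 p hp
      refine ⟨fun x => c * ψ x, contMDiffAt_const.mul hψ, ?_⟩
      filter_upwards [h] with x hx v
      simp only [Pi.smul_apply, smul_eq_mul, hx v]; ring
    · obtain ⟨ψ, hψ, h⟩ := ha3 p hp
      refine ⟨fun x => c * ψ x, contMDiffAt_const.mul hψ, ?_⟩
      filter_upwards [h] with x hx v
      have := hx v
      simp only [Pi.smul_apply, smul_eq_mul]
      linear_combination c * this

/-- The genus of a compact Riemann surface: the dimension of the space of holomorphic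
`1`-forms. -/
def genus (X : Type*) [TopologicalSpace X] [ChartedSpace ℂ X] : ℕ :=
  Module.finrank ℂ (logDifferentials X ∅ 1)

end Base

/-! ### Subbundles and their degree -/

section Bundles

variable {X : Type*} [TopologicalSpace X] [ChartedSpace ℂ X]
  {F : Type*} [NormedAddCommGroup F] [NormedSpace ℂ F] {E : X → Type*}
  [∀ x, AddCommGroup (E x)] [∀ x, Module ℂ (E x)] [∀ x, TopologicalSpace (E x)]
  [TopologicalSpace (TotalSpace F E)] [FiberBundle F E]

/-- `t` is a holomorphic frame, near `p`, of the family `S` of subspaces of the fibres of `E`. -/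
def IsLocalFrame (F : Type*) [NormedAddCommGroup F] [NormedSpace ℂ F]
    [TopologicalSpace (TotalSpace F E)] [FiberBundle F E]
    (S : ∀ x, Submodule ℂ (E x)) {k : ℕ} (t : Fin k → ∀ x, E x) (p : X) : Prop :=
  (∀ i, HolAt F (t i) p) ∧
    ∀ᶠ x in 𝓝 p, LinearIndependent ℂ (fun i => t i x) ∧
      Submodule.span ℂ (Set.range fun i => t i x) = S x

/-- `S` is a holomorphic subbundle of rank `k` of `E`. -/
def IsSubbundle (F : Type*) [NormedAddCommGroup F] [NormedSpace ℂ F]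
    [TopologicalSpace (TotalSpace F E)] [FiberBundle F E]
    (S : ∀ x, Submodule ℂ (E x)) (k : ℕ) : Prop :=
  ∀ p, ∃ t : Fin k → ∀ x, E x, IsLocalFrame F S t p

/-- The holomorphic subbundle `S` of rank `k` has degree `d`: there is a global meromorphic frame
`s` of `S` such that `d` is the sum over all points `p` of the order at `p` of `s₁ ∧ ⋯ ∧ s_k`
(a nonzero meromorphic section of `det S`), i.e. of the determinant of the matrix of `s` with
respect to a local holomorphic frame `t` at `p`. -/
def HasDegree (F : Type*) [NormedAddCommGroup F] [NormedSpace ℂ F]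
    [TopologicalSpace (TotalSpace F E)] [FiberBundle F E]
    (S : ∀ x, Submodule ℂ (E x)) (k : ℕ) (d : ℤ) : Prop :=
  ∃ (s : Fin k → ∀ x, E x) (o : X → ℤ),
    (∀ p, ∃ (t : Fin k → ∀ x, E x) (g : X → Matrix (Fin k) (Fin k) ℂ),
      IsLocalFrame F S t p ∧
      (∀ i j, MeromorphicAt (fun z => g ((chartAt ℂ p).symm z) i j) (chartAt ℂ p p)) ∧
      (∀ᶠ x in 𝓝[≠] p, ∀ j, s j x = ∑ i, g x i j • t i x) ∧
      meromorphicOrderAt (fun z => (g ((chartAt ℂ p).symm z)).det) (chartAt ℂ p p) =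
        (o p : WithTop ℤ)) ∧
    d = ∑ᶠ p, o p

/-- Let `P` be a parabolic structure at `p`. The germ at `p` of a section `u` (defined away from
`p`) belongs to the `τ`-th step `E_τ` of the associated decreasing filtration, indexed by real
numbers, of the meromorphic germs: `u = z^⌊τ⌋ · g` with `g` holomorphic at `p` and `g p` in the
part of the flag of weights at least the fractional part of `τ`. In particular `E_0` consists of
the holomorphic germs, and `E_{τ+1} = z · E_τ`. -/
def InParabolicStep (F : Type*) [NormedAddCommGroup F] [NormedSpace ℂ F]
    [TopologicalSpace (TotalSpace F E)] [FiberBundle F E]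
    {p : X} (P : WeightedFlag (E p)) (τ : ℝ) (u : ∀ x, E x) : Prop :=
  ∃ g : ∀ x, E x, HolAt F g p ∧ g p ∈ P.fil (Int.fract τ) ∧
    ∀ᶠ x in 𝓝[≠] p, u x = coordAt p x ^ ⌊τ⌋ • g x

end Bundles

/-! ### Symplectic parabolic bundles -/

section Symplectic

variable {X : Type*} [TopologicalSpace X] [ChartedSpace ℂ X] (D : Finset X) (n : ℕ)
  (E : X → Type*)
  [∀ x, AddCommGroup (E x)] [∀ x, Module ℂ (E x)] [∀ x, TopologicalSpace (E x)]
  [∀ x, IsTopologicalAddGroup (E x)] [∀ x, ContinuousSMul ℂ (E x)]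
  [TopologicalSpace (TotalSpace (Fin n → ℂ) E)] [FiberBundle (Fin n → ℂ) E]
  [VectorBundle ℂ (Fin n → ℂ) E]
  (L : X → Type*)
  [∀ x, AddCommGroup (L x)] [∀ x, Module ℂ (L x)] [∀ x, TopologicalSpace (L x)]
  [∀ x, IsTopologicalAddGroup (L x)] [∀ x, ContinuousSMul ℂ (L x)]
  [TopologicalSpace (TotalSpace ℂ L)] [FiberBundle ℂ L] [VectorBundle ℂ ℂ L]

/-- A symplectic parabolic structure, with parabolic points `D`, on the vector bundle `E` of rank
`n`, with values in the line bundle `L`. It consists of parabolic structures on `E` and `L` along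
`D` and an antisymmetric parabolic homomorphism `φ : E_* ⊗ E_* → L_*` whose adjoint
`E_* → L_* ⊗ E_*^∨` is an isomorphism of parabolic bundles.

Here `φ` is given by the holomorphic pairing `E ⊗ E → L` which it induces on underlying bundles.
That the adjoint is an isomorphism means nondegeneracy of `φ` on `X ∖ D`, and at `p ∈ D` the
condition `form_parabolic`: for all real `σ` the adjoint identifies the step `E_σ` of the parabolic
filtration of `E` with the step `σ` of the filtration of `L_* ⊗ E_*^∨ = Hom(E_*, L_*)`, which is
`{f | f (E_τ) ⊆ L_{σ+τ} for all τ}`. The forward direction of this condition says that `φ` is a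
parabolic homomorphism. -/
structure SymplecticParabolic where
  /-- the parabolic structure of `E` -/
  parE : ∀ p ∈ D, WeightedFlag (E p)
  /-- the parabolic structure of `L` -/
  parL : ∀ p ∈ D, WeightedFlag (L p)
  /-- the symplectic form -/
  form : ∀ x, E x →L[ℂ] E x →L[ℂ] L x
  form_hol : ∀ p, HolAt ((Fin n → ℂ) →L[ℂ] (Fin n → ℂ) →L[ℂ] ℂ) form p
  form_antisymm : ∀ x u v, form x u v = -form x v u
  form_nondegenerate : ∀ x ∉ D, ∀ u, (∀ v, form x u v = 0) → u = 0
  form_parabolic : ∀ p (hp : p ∈ D) (σ : ℝ) (u : ∀ x, E x),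
    InParabolicStep (Fin n → ℂ) (parE p hp) σ u ↔
      ∀ (τ : ℝ) (v : ∀ x, E x), InParabolicStep (Fin n → ℂ) (parE p hp) τ v →
        InParabolicStep ℂ (parL p hp) (σ + τ) (fun x => form x (u x) (v x))

/-- Parabolic slope of a subbundle `S` of rank `k` and degree `d`, with the induced parabolic
structure. -/
def parSlope {D : Finset X} {E : X → Type*} [∀ x, AddCommGroup (E x)] [∀ x, Module ℂ (E x)]
    (P : ∀ p ∈ D, WeightedFlag (E p)) (S : ∀ x, Submodule ℂ (E x)) (k : ℕ) (d : ℤ) : ℝ :=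
  ((d : ℝ) + ∑ p ∈ D.attach, (P p.1 p.2).weightSum (S p.1)) / k

variable {D n E L}

namespace SymplecticParabolic

/-- Stability: every nonzero isotropic holomorphic subbundle has smaller parabolic slope. -/
def IsStable (B : SymplecticParabolic D n E L) : Prop :=
  ∀ (S : ∀ x, Submodule ℂ (E x)) (k : ℕ), 0 < k → IsSubbundle (Fin n → ℂ) S k →
    (∀ x, ∀ u ∈ S x, ∀ v ∈ S x, B.form x u v = 0) →
    ∀ d e : ℤ, HasDegree (Fin n → ℂ) S k d →
      HasDegree (Fin n → ℂ) (fun x => (⊤ : Submodule ℂ (E x))) n e →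
      parSlope B.parE S k d < parSlope B.parE (fun x => (⊤ : Submodule ℂ (E x))) n e

/-- `W_E = H⁰(X, PEnd_Sp(E_*) ⊗ K(D))`, the space of symplectic parabolic Higgs fields.
On `X ∖ D` such a field is a holomorphic `1`-form with values in the endomorphisms of `E`. Near
`p ∈ D` it is `Ψ · dz / z`, with `Ψ` a holomorphic section of `End E` whose value at `p` (the
residue) preserves the flag. It is skew for the symplectic form. A field is determined by its
restriction to `X ∖ D`; the value at the points of `D` is fixed to be `0`. -/
def higgsFields (B : SymplecticParabolic D n E L) :
    Submodule ℂ (∀ x : X, TangentSpace 𝓘(ℂ) x →ₗ[ℂ] (E x →L[ℂ] E x)) where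
  carrier := {Φ |
    (∀ p ∈ D, Φ p = 0) ∧
    (∀ p ∉ D, ∃ Ψ : ∀ x, E x →L[ℂ] E x, HolAt ((Fin n → ℂ) →L[ℂ] (Fin n → ℂ)) Ψ p ∧
      ∀ᶠ x in 𝓝 p, ∀ v, Φ x v = dcoordAt p x v • Ψ x) ∧
    (∀ p (hp : p ∈ D), ∃ Ψ : ∀ x, E x →L[ℂ] E x,
      HolAt ((Fin n → ℂ) →L[ℂ] (Fin n → ℂ)) Ψ p ∧
      (∀ i, ∀ u ∈ (B.parE p hp).flag i, Ψ p u ∈ (B.parE p hp).flag i) ∧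
      ∀ᶠ x in 𝓝[≠] p, ∀ v, coordAt p x • Φ x v = dcoordAt p x v • Ψ x) ∧
    (∀ x v u w, B.form x (Φ x v u) w = -B.form x u (Φ x v w))}
  zero_mem' := by
    refine ⟨fun p _ => rfl, fun p _ => ⟨0, contMDiff_zeroSection ℂ _ |>.contMDiffAt, ?_⟩,
      fun p _ => ⟨0, contMDiff_zeroSection ℂ _ |>.contMDiffAt, ?_, ?_⟩, ?_⟩ <;> simp
  add_mem' := by
    rintro a b ⟨ha1, ha2, ha3, ha4⟩ ⟨hb1, hb2, hb3, hb4⟩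
    refine ⟨fun p hp => by simp [ha1 p hp, hb1 p hp], fun p hp => ?_, fun p hp => ?_, ?_⟩
    · obtain ⟨ψ, hψ, h⟩ := ha2 p hp
      obtain ⟨ψ', hψ', h'⟩ := hb2 p hp
      refine ⟨ψ + ψ', hψ.add_section hψ', ?_⟩
      filter_upwards [h, h'] with x hx hx' v
      simp only [Pi.add_apply, LinearMap.add_apply, hx v, hx' v, smul_add]
    · obtain ⟨ψ, hψ, hf, h⟩ := ha3 p hp
      obtain ⟨ψ', hψ', hf', h'⟩ := hb3 p hp
      refine ⟨ψ + ψ', hψ.add_section hψ', fun i u hu => ?_, ?_⟩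
      · exact Submodule.add_mem _ (hf i u hu) (hf' i u hu)
      · filter_upwards [h, h'] with x hx hx' v
        simp only [Pi.add_apply, LinearMap.add_apply, hx v, hx' v, smul_add]
    · intro x v u w
      simp only [Pi.add_apply, LinearMap.add_apply, add_apply, map_add, ha4 x v u w, hb4 x v u w,
        neg_add]
  smul_mem' := by
    rintro c a ⟨ha1, ha2, ha3, ha4⟩
    refine ⟨fun p hp => by simp [ha1 p hp], fun p hp => ?_, fun p hp => ?_, ?_⟩
    · obtain ⟨ψ, hψ, h⟩ := ha2 p hp
      refine ⟨c • ψ, hψ.const_smul_section, ?_⟩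
      filter_upwards [h] with x hx v
      simp only [Pi.smul_apply, LinearMap.smul_apply, hx v]
      rw [smul_comm]
    · obtain ⟨ψ, hψ, hf, h⟩ := ha3 p hp
      refine ⟨c • ψ, hψ.const_smul_section, fun i u hu => ?_, ?_⟩
      · exact Submodule.smul_mem _ c (hf i u hu)
      · filter_upwards [h] with x hx v
        simp only [Pi.smul_apply, LinearMap.smul_apply]
        rw [smul_comm, hx v, smul_comm]
    · intro x v u w
      simp only [Pi.smul_apply, LinearMap.smul_apply, smul_apply, map_smul, ha4 x v u w, smul_neg]

/-- A Higgs field is nilpotent if all its values are nilpotent endomorphisms. -/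
def IsNilpotentField (Φ : ∀ x : X, TangentSpace 𝓘(ℂ) x →ₗ[ℂ] (E x →L[ℂ] E x)) : Prop :=
  ∀ x v, IsNilpotent (Φ x v)

/-- Very stability: there is no nonzero nilpotent symplectic parabolic Higgs field. -/
def IsVeryStable (B : SymplecticParabolic D n E L) : Prop :=
  ∀ Φ ∈ B.higgsFields, IsNilpotentField Φ → Φ = 0

end SymplecticParabolic

end Symplectic

/-! ### The Hitchin map -/

/-- Fibres of a vector bundle of finite rank are finite-dimensional. -/
theorem fiber_finite {X : Type*} [TopologicalSpace X] (n : ℕ) (E : X → Type*)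
    [∀ x, AddCommGroup (E x)] [∀ x, Module ℂ (E x)] [∀ x, TopologicalSpace (E x)]
    [TopologicalSpace (TotalSpace (Fin n → ℂ) E)] [FiberBundle (Fin n → ℂ) E]
    [VectorBundle ℂ (Fin n → ℂ) E] (x : X) : Module.Finite ℂ (E x) :=
  Module.Finite.equiv ((trivializationAt (Fin n → ℂ) E x).continuousLinearEquivAt ℂ x
    (FiberBundle.mem_baseSet_trivializationAt' x)).symm.toLinearEquiv

/-- The coefficient `s_j` of `T ^ (n - j)` in the characteristic polynomial
`det (T - A) = T ^ n + s₁ T ^ (n - 1) + ⋯ + s_n` of an endomorphism `A` of the fibre at `x` of a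
bundle of rank `n`. -/
def charCoeff {X : Type*} [TopologicalSpace X] (n : ℕ) {E : X → Type*}
    [∀ x, AddCommGroup (E x)] [∀ x, Module ℂ (E x)] [∀ x, TopologicalSpace (E x)]
    [TopologicalSpace (TotalSpace (Fin n → ℂ) E)] [FiberBundle (Fin n → ℂ) E]
    [VectorBundle ℂ (Fin n → ℂ) E] (j : ℕ) {x : X} (A : E x →L[ℂ] E x) : ℂ :=
  haveI := fiber_finite n E x
  (LinearMap.charpoly (A : E x →ₗ[ℂ] E x)).coeff (n - j)

theorem charCoeff_eq {X : Type*} [TopologicalSpace X] {n : ℕ} {E : X → Type*}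
    [∀ x, AddCommGroup (E x)] [∀ x, Module ℂ (E x)] [∀ x, TopologicalSpace (E x)]
    [TopologicalSpace (TotalSpace (Fin n → ℂ) E)] [FiberBundle (Fin n → ℂ) E]
    [VectorBundle ℂ (Fin n → ℂ) E]
    (j : ℕ) {x : X} (e : E x ≃ₗ[ℂ] (Fin n → ℂ)) (A : E x →L[ℂ] E x) :
    charCoeff n j A =
      (LinearMap.toMatrix (Pi.basisFun ℂ (Fin n)) (Pi.basisFun ℂ (Fin n))
        (e.conj (A : E x →ₗ[ℂ] E x))).charpoly.coeff (n - j) := by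
  have := fiber_finite n E x
  unfold charCoeff
  rw [LinearMap.charpoly_toMatrix, LinearEquiv.charpoly_conj]

theorem charCoeff_smul {X : Type*} [TopologicalSpace X] {n : ℕ} {E : X → Type*}
    [∀ x, AddCommGroup (E x)] [∀ x, Module ℂ (E x)] [∀ x, TopologicalSpace (E x)]
    [∀ x, ContinuousSMul ℂ (E x)]
    [TopologicalSpace (TotalSpace (Fin n → ℂ) E)] [FiberBundle (Fin n → ℂ) E]
    [VectorBundle ℂ (Fin n → ℂ) E]
    {j : ℕ} (hj : j ≤ n) {x : X} (c : ℂ) (A : E x →L[ℂ] E x) :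
    charCoeff n j (c • A) = c ^ j * charCoeff n j A := by
  have e := ((trivializationAt (Fin n → ℂ) E x).continuousLinearEquivAt ℂ x
    (FiberBundle.mem_baseSet_trivializationAt' x)).toLinearEquiv
  rw [charCoeff_eq j e, charCoeff_eq j e]
  simp only [ContinuousLinearMap.toLinearMap_smul, map_smul]
  set M := LinearMap.toMatrix (Pi.basisFun ℂ (Fin n)) (Pi.basisFun ℂ (Fin n))
    (e.conj (A : E x →ₗ[ℂ] E x))
  have h := Matrix.charpoly.univ_coeff_isHomogeneous ℂ (Fin n) (n - j) j (by simp; omega)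
  have key : ∀ N : Matrix (Fin n) (Fin n) ℂ, N.charpoly.coeff (n - j) =
      MvPolynomial.eval (fun ij => N ij.1 ij.2)
        ((Matrix.charpoly.univ ℂ (Fin n)).coeff (n - j)) := by
    intro N
    exact (Matrix.charpoly.univ_coeff_eval₂Hom (Fin n) (RingHom.id ℂ)
      (fun ij => N ij.1 ij.2) (n - j)).symm
  rw [key, key]
  rw [MvPolynomial.eval_eq, MvPolynomial.eval_eq, Finset.mul_sum]
  refine Finset.sum_congr rfl fun d hd => ?_
  have hdeg : ∑ i ∈ d.support, d i = j := by
    have := h (MvPolynomial.mem_support_iff.1 hd)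
    simpa [Finsupp.weight_apply, Finsupp.sum] using this
  simp only [Matrix.smul_apply, smul_eq_mul, mul_pow, Finset.prod_mul_distrib,
    Finset.prod_pow_eq_pow_sum, hdeg]
  ring

section Hitchin

variable {X : Type*} [TopologicalSpace X] [ChartedSpace ℂ X] {D : Finset X} {n : ℕ}
  {E : X → Type*}
  [∀ x, AddCommGroup (E x)] [∀ x, Module ℂ (E x)] [∀ x, TopologicalSpace (E x)]
  [∀ x, IsTopologicalAddGroup (E x)] [∀ x, ContinuousSMul ℂ (E x)]
  [TopologicalSpace (TotalSpace (Fin n → ℂ) E)] [FiberBundle (Fin n → ℂ) E]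
  [VectorBundle ℂ (Fin n → ℂ) E]
  {L : X → Type*}
  [∀ x, AddCommGroup (L x)] [∀ x, Module ℂ (L x)] [∀ x, TopologicalSpace (L x)]
  [∀ x, IsTopologicalAddGroup (L x)] [∀ x, ContinuousSMul ℂ (L x)]
  [TopologicalSpace (TotalSpace ℂ L)] [FiberBundle ℂ L] [VectorBundle ℂ ℂ L]

theorem charCoeff_contMDiffAt (j : ℕ) {p : X} {Ψ : ∀ x, E x →L[ℂ] E x}
    (h : HolAt ((Fin n → ℂ) →L[ℂ] (Fin n → ℂ)) Ψ p) :
    ContMDiffAt 𝓘(ℂ) 𝓘(ℂ) ω (fun x => charCoeff n j (Ψ x)) p := by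
  have h1 := ((contMDiffAt_hom_bundle _).1 h).2
  have h2 : ContDiff ℂ ω (fun T : (Fin n → ℂ) →L[ℂ] (Fin n → ℂ) =>
      (LinearMap.toMatrix (Pi.basisFun ℂ (Fin n)) (Pi.basisFun ℂ (Fin n))
        (T : (Fin n → ℂ) →ₗ[ℂ] (Fin n → ℂ))).charpoly.coeff (n - j)) := by
    have key : ∀ N : Matrix (Fin n) (Fin n) ℂ, N.charpoly.coeff (n - j) =
        MvPolynomial.aeval (fun ij => N ij.1 ij.2)
          ((Matrix.charpoly.univ ℂ (Fin n)).coeff (n - j)) := by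
      intro N
      exact (Matrix.charpoly.univ_coeff_eval₂Hom (Fin n) (RingHom.id ℂ)
        (fun ij => N ij.1 ij.2) (n - j)).symm
    simp only [key]
    rw [contDiff_omega_iff_analyticOnNhd]
    intro T _
    apply AnalyticAt.aeval_mvPolynomial
    intro ij
    simp only [LinearMap.toMatrix_apply, Pi.basisFun_apply, Pi.basisFun_repr]
    exact ((ContinuousLinearMap.proj ij.1).comp
      (ContinuousLinearMap.apply ℂ (Fin n → ℂ) (Pi.single ij.2 1))).analyticAt T
  refine (h2.contMDiff.contMDiffAt.comp p h1).congr_of_eventuallyEq ?_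
  have hb : (trivializationAt (Fin n → ℂ) E p).baseSet ∈ 𝓝 p :=
    (trivializationAt (Fin n → ℂ) E p).open_baseSet.mem_nhds
      (FiberBundle.mem_baseSet_trivializationAt' p)
  filter_upwards [hb] with x hx
  rw [charCoeff_eq j ((trivializationAt (Fin n → ℂ) E p).continuousLinearEquivAt ℂ x
    hx).toLinearEquiv]
  simp only [Function.comp]
  rw [ContinuousLinearMap.inCoordinates_eq hx hx]
  rfl

/-- The coefficients `s_j` of a symplectic parabolic Higgs field are sections of `K(D)^j`. -/
theorem charCoeff_mem (B : SymplecticParabolic D n E L) {j : ℕ} (hj0 : 0 < j) (hj : j ≤ n)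
    {Φ : ∀ x : X, TangentSpace 𝓘(ℂ) x →ₗ[ℂ] (E x →L[ℂ] E x)} (hΦ : Φ ∈ B.higgsFields) :
    (fun x v => charCoeff n j (Φ x v)) ∈ logDifferentials X D j := by
  obtain ⟨h1, h2, h3, -⟩ := hΦ
  refine ⟨fun p hp => ?_, fun p hp => ?_, fun p hp => ?_⟩
  · funext v
    have := charCoeff_smul hj (0 : ℂ) (Φ p v)
    simpa [h1 p hp, hj0.ne'] using this
  · obtain ⟨Ψ, hΨ, h⟩ := h2 p hp
    refine ⟨_, charCoeff_contMDiffAt j hΨ, ?_⟩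
    filter_upwards [h] with x hx v
    rw [hx v, charCoeff_smul hj]
  · obtain ⟨Ψ, hΨ, -, h⟩ := h3 p hp
    refine ⟨_, charCoeff_contMDiffAt j hΨ, ?_⟩
    filter_upwards [h] with x hx v
    rw [← charCoeff_smul hj, hx v, charCoeff_smul hj]

/-- The base `A_Sp = ⨁_{i = 1}^m H⁰(X, K(D)^{2i})` of the symplectic Hitchin map. -/
abbrev HitchinBase (X : Type*) [TopologicalSpace X] [ChartedSpace ℂ X] (D : Finset X) (m : ℕ) :=
  ∀ i : Fin m, logDifferentials X D (2 * ((i : ℕ) + 1))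

/-- The Hitchin map `h_E : W_E → A_Sp` of a symplectic parabolic bundle of rank `2m`, sending a
Higgs field to the coefficients `(s₂, s₄, …, s_{2m})` of its characteristic polynomial. -/
def SymplecticParabolic.hitchinMap {m : ℕ} {E : X → Type*}
    [∀ x, AddCommGroup (E x)] [∀ x, Module ℂ (E x)] [∀ x, TopologicalSpace (E x)]
    [∀ x, IsTopologicalAddGroup (E x)] [∀ x, ContinuousSMul ℂ (E x)]
    [TopologicalSpace (TotalSpace (Fin (2 * m) → ℂ) E)] [FiberBundle (Fin (2 * m) → ℂ) E]
    [VectorBundle ℂ (Fin (2 * m) → ℂ) E]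
    (B : SymplecticParabolic D (2 * m) E L) (Φ : B.higgsFields) : HitchinBase X D m :=
  fun i => ⟨fun x v => charCoeff (2 * m) (2 * ((i : ℕ) + 1)) (Φ.1 x v),
    charCoeff_mem B (by omega) (by have := i.2; omega) Φ.2⟩

end Hitchin

/-! ### Finite and quasi-finite maps between affine spaces -/

/-- The algebra of polynomial functions on a complex vector space `V`: the algebra of functions
generated by the linear forms. For finite-dimensional `V` it is the coordinate ring of the affine
space `V`. -/
def polyFun (V : Type*) [AddCommGroup V] [Module ℂ V] : Subalgebra ℂ (V → ℂ) :=
  Algebra.adjoin ℂ (Set.range fun l : Module.Dual ℂ V => (l : V → ℂ))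

/-- `h : V → W` is a finite morphism of affine spaces: composition with `h` maps polynomial
functions on `W` to polynomial functions on `V`, and makes the coordinate ring of `V` a finite
module over the coordinate ring of `W`. -/
def IsFiniteMorphism {V W : Type*} [AddCommGroup V] [Module ℂ V] [AddCommGroup W] [Module ℂ W]
    (h : V → W) : Prop :=
  ∃ ψ : polyFun W →ₐ[ℂ] polyFun V,
    (∀ (f : polyFun W) (v : V), (ψ f : V → ℂ) v = (f : W → ℂ) (h v)) ∧ ψ.Finite

/-- A morphism of complex affine varieties is quasi-finite if it has finite fibres. -/
def IsQuasiFinite {V W : Type*} (h : V → W) : Prop :=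
  ∀ w, (h ⁻¹' {w}).Finite

end ParabolicHiggs

end

noncomputable section

namespace ParabolicHiggs

/-! ### Linear algebra of skew endomorphisms -/

/-! Write W for the space of Higgs fields. Everything rests on the fibre of the Hitchin map over 0,
which consists exactly of the nilpotent fields. A nilpotent field has vanishing characteristic
coefficients. Conversely, skewness for a nondegenerate form kills the odd coefficients
(`charCoeff_eq_zero_of_odd_of_skew`), so the vanishing of s₂, …, s_{2m} leaves x^{2m} as
characteristic polynomial.

Quasi-finite implies very stable: nilpotency is invariant under scaling, so a nonzero nilpotent
field spans a complex line inside the zero fibre.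

Very stable implies finite: the zero fibre is {0}, and the components of the map are homogeneous
polynomials of positive degree on W. By the Nullstellensatz the ideal they generate contains a power
of every coordinate. A graded Nakayama argument (`mem_of_homogeneous_generators`) then shows that
finitely many monomials generate the coordinate ring of W over that of the base. This is
`isFiniteMorphism_of_homogeneous`.

Two inputs remain. W is finite-dimensional: on a compact surface, a section whose Taylor
coefficients vanish to high order at finitely many centres is forced to be zero by the Schwarz
estimate (`finiteDimensional_of_local_holomorphic`). And every linear form on the base must pull
back to a homogeneous polynomial, although only point evaluations of differentials visibly do so;
`comp_linear_mem_of_eval_mem` bridges this by duality, in any dimension of the base. -/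

theorem charpoly_dualMap {V : Type*} [AddCommGroup V] [Module ℂ V] [Module.Finite ℂ V]
    (A : V →ₗ[ℂ] V) : A.dualMap.charpoly = A.charpoly := by
  have b := Module.finBasis ℂ V
  rw [← LinearMap.charpoly_toMatrix A b, ← LinearMap.charpoly_toMatrix A.dualMap b.dualBasis,
    LinearMap.dualMap_def, LinearMap.toMatrix_transpose, Matrix.charpoly_transpose]

/-- Skewness says that `β`, as an isomorphism onto the dual, conjugates `-A` into the transpose of
`A`, and transposition preserves the characteristic polynomial. -/
theorem charpoly_neg_of_skew {V : Type*} [AddCommGroup V] [Module ℂ V] [Module.Finite ℂ V]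
    (β : V →ₗ[ℂ] Module.Dual ℂ V) (hβ : Function.Injective β) (A : V →ₗ[ℂ] V)
    (hA : ∀ u w, β (A u) w = -β u (A w)) : (-A).charpoly = A.charpoly := by
  let e : V ≃ₗ[ℂ] Module.Dual ℂ V :=
    LinearEquiv.ofInjectiveOfFinrankEq β hβ (Subspace.dual_finrank_eq).symm
  have h : e.conj (-A) = A.dualMap := by
    ext f w
    obtain ⟨u, rfl⟩ := e.surjective f
    have h1 : ∀ u, e u = β u := fun u => rfl
    have h2 : e.symm (β u) = u := by rw [← h1, e.symm_apply_apply]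
    simp [LinearEquiv.conj_apply, h1, hA, h2]
  rw [← LinearEquiv.charpoly_conj e, h, charpoly_dualMap]

section Fibre

variable {X : Type*} [TopologicalSpace X] {n : ℕ} {E : X → Type*}
  [∀ x, AddCommGroup (E x)] [∀ x, Module ℂ (E x)] [∀ x, TopologicalSpace (E x)]
  [∀ x, IsTopologicalAddGroup (E x)] [∀ x, ContinuousSMul ℂ (E x)]
  [TopologicalSpace (TotalSpace (Fin n → ℂ) E)] [FiberBundle (Fin n → ℂ) E]
  [VectorBundle ℂ (Fin n → ℂ) E]

theorem finrank_fiber (E : X → Type*)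
    [∀ x, AddCommGroup (E x)] [∀ x, Module ℂ (E x)] [∀ x, TopologicalSpace (E x)]
    [TopologicalSpace (TotalSpace (Fin n → ℂ) E)] [FiberBundle (Fin n → ℂ) E]
    [VectorBundle ℂ (Fin n → ℂ) E] (x : X) : Module.finrank ℂ (E x) = n := by
  rw [LinearEquiv.finrank_eq ((trivializationAt (Fin n → ℂ) E x).continuousLinearEquivAt ℂ x
    (FiberBundle.mem_baseSet_trivializationAt' x)).toLinearEquiv]
  simp

theorem isNilpotent_toLinearMap_iff {V : Type*} [AddCommGroup V] [Module ℂ V]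
    [TopologicalSpace V] [IsTopologicalAddGroup V] (A : V →L[ℂ] V) :
    IsNilpotent (A : V →ₗ[ℂ] V) ↔ IsNilpotent A :=
  IsNilpotent.map_iff (f := ContinuousLinearMap.toLinearMapRingHom (R₁ := ℂ) (M₁ := V))
    ContinuousLinearMap.coe_injective

theorem charCoeff_eq_zero_of_isNilpotent {x : X} {A : E x →L[ℂ] E x} (hA : IsNilpotent A)
    {j : ℕ} (h0 : 0 < j) (hj : j ≤ n) : charCoeff n j A = 0 := by
  have := fiber_finite n E x
  have h := (isNilpotent_toLinearMap_iff A).2 hA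
  rw [LinearMap.isNilpotent_iff_charpoly, finrank_fiber (n := n) E x] at h
  unfold charCoeff
  rw [h, Polynomial.coeff_X_pow, if_neg (by omega)]

theorem isNilpotent_of_charCoeff_eq_zero {x : X} {A : E x →L[ℂ] E x}
    (h : ∀ j, 0 < j → j ≤ n → charCoeff n j A = 0) : IsNilpotent A := by
  have := fiber_finite n E x
  rw [← isNilpotent_toLinearMap_iff, LinearMap.isNilpotent_iff_charpoly, finrank_fiber (n := n) E x]
  have hdeg : (A : E x →ₗ[ℂ] E x).charpoly.natDegree = n := by
    rw [LinearMap.charpoly_natDegree, finrank_fiber (n := n) E x]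
  ext k
  rw [Polynomial.coeff_X_pow]
  split_ifs with hk
  · subst hk
    have := (LinearMap.charpoly_monic (A : E x →ₗ[ℂ] E x)).coeff_natDegree
    rwa [hdeg] at this
  · rcases lt_or_gt_of_ne hk with hk | hk
    · have := h (n - k) (by omega) (by omega)
      unfold charCoeff at this
      rwa [Nat.sub_sub_self hk.le] at this
    · exact Polynomial.coeff_eq_zero_of_natDegree_lt (by omega)

/-- Homogeneity gives s_j(-A) = (-1)^j s_j(A), while skewness gives s_j(-A) = s_j(A). The
isomorphism `eL` makes the line-valued form scalar. -/
theorem charCoeff_eq_zero_of_odd_of_skew {M : Type*} [AddCommGroup M] [Module ℂ M]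
    (eL : M ≃ₗ[ℂ] ℂ) {x : X} (β : E x →ₗ[ℂ] E x →ₗ[ℂ] M) (hβ : ∀ u, (∀ v, β u v = 0) → u = 0)
    {A : E x →L[ℂ] E x} (hA : ∀ u w, β (A u) w = -β u (A w)) {j : ℕ} (hj : j ≤ n)
    (ho : Odd j) : charCoeff n j A = 0 := by
  have := fiber_finite n E x
  have h1 : charCoeff n j ((-1 : ℂ) • A) = charCoeff n j A := by
    unfold charCoeff
    rw [← charpoly_neg_of_skew (β.compr₂ eL.toLinearMap) ?_ (A : E x →ₗ[ℂ] E x) ?_]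
    · simp
    · rw [injective_iff_map_eq_zero]
      intro u hu
      refine hβ u fun v => ?_
      have := LinearMap.congr_fun hu v
      simpa using this
    · intro u w
      simp [hA]
  rw [charCoeff_smul hj, ho.neg_one_pow] at h1
  linear_combination (-1 / 2 : ℂ) * h1

end Fibre

/-! ### Homogeneous polynomial maps with trivial zero fibre are finite -/

/-- If every coordinate of a map `h` into a space of functions lies in a finite-dimensional space
`P` of functions, then so does every linear form composed with `h`. -/
theorem comp_linear_mem_of_eval_mem {V Y A : Type*} [AddCommGroup A] [Module ℂ A]
    (ε : A →ₗ[ℂ] (Y → ℂ)) (hε : Function.Injective ε) (h : V → A) (P : Submodule ℂ (V → ℂ))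
    [FiniteDimensional ℂ P] (hP : ∀ y, (fun v => ε (h v) y) ∈ P) (l : Module.Dual ℂ A) :
    (fun v => l (h v)) ∈ P := by
  let e : (V → ℂ) ≃ₗ[ℂ] Module.Dual ℂ (V →₀ ℂ) := Finsupp.llift ℂ ℂ ℂ V
  have he : ∀ f μ, e f μ = μ.sum fun v c => c * f v := fun f μ => by
    simp [e]
  let Q : Subspace ℂ (Module.Dual ℂ (V →₀ ℂ)) := P.map e.toLinearMap
  have : FiniteDimensional ℂ Q := Module.Finite.map P e.toLinearMap
  have hQ : e (fun v => l (h v)) ∈ Q := by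
    -- A finite-dimensional subspace of a dual is the annihilator of its coannihilator. So it
    -- suffices to test against finite combinations `μ` of points of `V` killed by `P`. For these,
    -- all coordinates of ∑ μ_v h(v) vanish, hence so does the vector itself by injectivity of `ε`,
    -- and `l` sends it to 0.
    rw [← Subspace.dualCoannihilator_dualAnnihilator_eq (W := Q), Submodule.mem_dualAnnihilator]
    intro μ hμ
    rw [Submodule.mem_dualCoannihilator] at hμ
    have hz : (μ.sum fun v c => c • h v) = 0 := by
      apply hε
      funext y
      have := hμ _ (Submodule.mem_map_of_mem (hP y))
      simp only [LinearEquiv.coe_coe] at this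
      rw [he] at this
      simpa [Finsupp.sum] using this
    rw [he]
    have := congrArg l hz
    simpa [Finsupp.sum, map_sum] using this
  obtain ⟨f, hf, hfe⟩ := hQ
  rwa [← e.injective hfe]

section Finite

open MvPolynomial

/-- Graded Nakayama lemma for polynomial rings: let `N` be a subspace closed under multiplication
by a set `H` of homogeneous polynomials of positive degree which generates an ideal containing a
power of each variable. If `N` contains the monomials with small exponents, it contains everything. -/
theorem mem_of_homogeneous_generators {d : ℕ} (H : Set (MvPolynomial (Fin d) ℂ))
    (hH : ∀ f ∈ H, ∃ j, 0 < j ∧ f.IsHomogeneous j) (N : Submodule ℂ (MvPolynomial (Fin d) ℂ))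
    (hN : ∀ f ∈ H, ∀ q ∈ N, q * f ∈ N) (K : ℕ) (hK : ∀ i, X i ^ K ∈ Ideal.span H)
    (hmon : ∀ α : Fin d →₀ ℕ, (∀ i, α i < K) → monomial α 1 ∈ N) (q : MvPolynomial (Fin d) ℂ) :
    q ∈ N := by
  have key : ∀ (k : ℕ) (q : MvPolynomial (Fin d) ℂ), q.IsHomogeneous k → q ∈ N := by
    intro k
    induction k using Nat.strong_induction_on with
    | _ k ih =>
    have hI : ∀ q ∈ Ideal.span H, homogeneousComponent k q ∈ N := by
      -- The degree-`k` part of c·f, with f in `H` of degree j > 0, is the degree-(k - j) part of c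
      -- times f. The first factor lies in `N` by induction.
      intro q hq
      obtain ⟨c, hc, rfl⟩ := Submodule.mem_span_set.1 hq
      rw [Finsupp.sum, map_sum]
      refine N.sum_mem fun f hf => ?_
      obtain ⟨j, hj, hfj⟩ := hH f (hc hf)
      rw [smul_eq_mul, (c f).as_sum, Finset.sum_mul, map_sum]
      refine N.sum_mem fun β _ => ?_
      have hβ : (monomial β ((c f).coeff β)).IsHomogeneous β.degree := isHomogeneous_monomial _ rfl
      have hp := hβ.mul hfj
      rw [homogeneousComponent_of_mem hp]
      split_ifs with hk
      · exact hN f (hc hf) _ (ih _ (by omega) _ hβ)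
      · exact N.zero_mem
    intro q hq
    rw [q.as_sum]
    refine N.sum_mem fun α hα => ?_
    by_cases hs : ∀ i, α i < K
    · have := N.smul_mem (q.coeff α) (hmon α hs)
      rwa [smul_monomial, smul_eq_mul, mul_one] at this
    -- A monomial with some exponent at least `K` is divisible by X_i ^ K, hence lies in the ideal,
    -- and it equals its own degree-`k` component.
    · push Not at hs
      obtain ⟨i, hi⟩ := hs
      have hh : (monomial α (q.coeff α)).IsHomogeneous k :=
        isHomogeneous_monomial _ (hq (mem_support_iff.1 hα) ▸ by
          rw [Finsupp.degree_eq_weight_one]; rfl)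
      rw [← homogeneousComponent_eq_self hh]
      apply hI
      have : monomial α (q.coeff α) = monomial (α - Finsupp.single i K) (q.coeff α) * X i ^ K := by
        rw [X_pow_eq_monomial, monomial_mul, mul_one, tsub_add_cancel_of_le]
        simpa using hi
      rw [this]
      exact Ideal.mul_mem_left _ _ (hK i)
  rw [← sum_homogeneousComponent q]
  exact N.sum_mem fun k _ => key k _ (homogeneousComponent_isHomogeneous k q)

/-- The algebra homomorphism sending a polynomial to the function it defines in the coordinates of
a basis. -/
def polyEval {V : Type*} [AddCommMonoid V] [Module ℂ V] {d : ℕ} (b : Module.Basis (Fin d) ℂ V) :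
    MvPolynomial (Fin d) ℂ →ₐ[ℂ] (V → ℂ) :=
  MvPolynomial.aeval fun i v => b.repr v i

theorem polyEval_apply {V : Type*} [AddCommMonoid V] [Module ℂ V] {d : ℕ}
    (b : Module.Basis (Fin d) ℂ V) (q : MvPolynomial (Fin d) ℂ) (v : V) :
    polyEval b q v = eval (b.repr v) q := by
  have : ((Pi.evalAlgHom ℂ (fun _ : V => ℂ) v).comp (polyEval b)) =
      MvPolynomial.aeval (b.repr v : Fin d → ℂ) := by
    ext i
    simp [polyEval]
  have h := DFunLike.congr_fun this q
  simpa [MvPolynomial.aeval_eq_eval] using h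

/-- Links the coordinate-free `polyFun` with the polynomial ring, where the Nullstellensatz and the
grading are available. -/
theorem range_polyEval {V : Type*} [AddCommGroup V] [Module ℂ V] {d : ℕ}
    (b : Module.Basis (Fin d) ℂ V) : (polyEval b).range = polyFun V := by
  apply le_antisymm
  · rintro _ ⟨q, rfl⟩
    induction q using MvPolynomial.induction_on with
    | C a => simp [polyEval]
    | add p q hp hq => simpa using (polyFun V).add_mem hp hq
    | mul_X p i hp =>
      simp only [map_mul] at hp ⊢
      refine (polyFun V).mul_mem hp (Algebra.subset_adjoin ⟨b.coord i, ?_⟩)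
      ext v
      simp [polyEval]
  · refine Algebra.adjoin_le ?_
    rintro _ ⟨l, rfl⟩
    refine ⟨∑ i, C (l (b i)) * X i, ?_⟩
    ext v
    refine (polyEval_apply b _ v).trans ?_
    have := congrArg l (b.sum_repr v)
    rw [map_sum] at this
    simpa [mul_comm] using this

/-- A map into a space of functions all of whose values are homogeneous polynomials is given by
homogeneous polynomials. -/
theorem exists_isHomogeneous_comp_linear {V Y A : Type*} [AddCommMonoid V] [Module ℂ V] {d : ℕ}
    (b : Module.Basis (Fin d) ℂ V) [AddCommGroup A] [Module ℂ A] (ε : A →ₗ[ℂ] (Y → ℂ))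
    (hε : Function.Injective ε) (h : V → A) (k : ℕ)
    (hq : ∀ y, ∃ q : MvPolynomial (Fin d) ℂ, q.IsHomogeneous k ∧
      ∀ v, ε (h v) y = eval (b.repr v) q) (l : Module.Dual ℂ A) :
    ∃ q : MvPolynomial (Fin d) ℂ, q.IsHomogeneous k ∧ ∀ v, l (h v) = eval (b.repr v) q := by
  have : FiniteDimensional ℂ ((homogeneousSubmodule (Fin d) ℂ k).map (polyEval b).toLinearMap) :=
    Module.Finite.iff_fg.2 ((homogeneousSubmodule_fg (Fin d) ℂ k).map _)
  have hP : ∀ y, (fun v => ε (h v) y) ∈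
      (homogeneousSubmodule (Fin d) ℂ k).map (polyEval b).toLinearMap := by
    intro y
    obtain ⟨q, hqk, hqe⟩ := hq y
    refine Submodule.mem_map.2 ⟨q, (mem_homogeneousSubmodule k q).2 hqk, ?_⟩
    funext v
    exact (polyEval_apply b q v).trans (hqe v).symm
  obtain ⟨q, hqk, hqe⟩ := Submodule.mem_map.1 (comp_linear_mem_of_eval_mem ε hε h _ hP l)
  refine ⟨q, (mem_homogeneousSubmodule k q).1 hqk, fun v => ?_⟩
  rw [← polyEval_apply b q v]
  exact (congrFun hqe v).symm

/-- A map given by homogeneous polynomials of positive degrees, whose only zero is the origin, is a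
finite morphism. -/
theorem isFiniteMorphism_of_homogeneous {V : Type*} [AddCommGroup V] [Module ℂ V] {ι : Type*}
    [Fintype ι] [DecidableEq ι] {A : ι → Type*} [∀ i, AddCommGroup (A i)] [∀ i, Module ℂ (A i)]
    (h : V → ∀ i, A i) (k : ι → ℕ) (hk : ∀ i, 0 < k i) {d : ℕ} (b : Module.Basis (Fin d) ℂ V)
    (hpoly : ∀ i (l : Module.Dual ℂ (A i)), ∃ q : MvPolynomial (Fin d) ℂ, q.IsHomogeneous (k i) ∧
      ∀ v, l (h v i) = eval (b.repr v) q)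
    (hzero : ∀ v, h v = 0 → v = 0) : IsFiniteMorphism h := by
  let comp : ((∀ i, A i) → ℂ) →ₐ[ℂ] (V → ℂ) :=
    { toFun := fun f v => f (h v)
      map_one' := rfl
      map_mul' := fun _ _ => rfl
      map_zero' := rfl
      map_add' := fun _ _ => rfl
      commutes' := fun _ => rfl }
  have hcomp : ∀ f ∈ polyFun (∀ i, A i), comp f ∈ polyFun V := by
    change polyFun _ ≤ (polyFun V).comap comp
    refine Algebra.adjoin_le ?_
    rintro _ ⟨l, rfl⟩
    change comp l ∈ polyFun V
    have hl : comp l = ∑ i, fun v => l.comp (LinearMap.single ℂ A i) (h v i) := by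
      ext v
      simp only [Finset.sum_apply, LinearMap.comp_apply]
      rw [← map_sum]
      change l (h v) = _
      congr 1
      exact (Finset.univ_sum_single (h v)).symm
    rw [hl]
    refine Subalgebra.sum_mem _ fun i _ => ?_
    obtain ⟨q, -, hq⟩ := hpoly i (l.comp (LinearMap.single ℂ A i))
    rw [← range_polyEval b]
    exact ⟨q, funext fun v => by simp [polyEval_apply, hq v]⟩
  let ψ : polyFun (∀ i, A i) →ₐ[ℂ] polyFun V :=
    (comp.comp (polyFun _).val).codRestrict (polyFun V) fun f => hcomp f f.2
  refine ⟨ψ, fun f v => rfl, ?_⟩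
  -- Homogeneous polynomials of positive degree whose functions are pulled back along `h`.
  -- Multiplying by one of them is a scalar action of the coordinate ring of the target.
  let H : Set (MvPolynomial (Fin d) ℂ) :=
    {q | ∃ j, 0 < j ∧ q.IsHomogeneous j ∧ ∃ f, ψ f = polyEval b q}
  have hrad : ∀ i, X i ∈ (Ideal.span H).radical := by
    intro i
    -- By the Nullstellensatz it is enough that every common zero of `H` is the origin. `H` contains
    -- the pullbacks of linear forms on each factor; these separate points, so a common zero is a
    -- zero of `h`.
    rw [← vanishingIdeal_zeroLocus_eq_radical (K := ℂ), mem_vanishingIdeal_iff]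
    intro t ht
    obtain ⟨v, rfl⟩ : ∃ v, t = b.repr v :=
      ⟨b.repr.symm (Finsupp.equivFunOnFinite.symm t), by simp⟩
    have hv : h v = 0 := by
      funext i
      rw [Pi.zero_apply, ← Module.forall_dual_apply_eq_zero_iff ℂ]
      intro l
      obtain ⟨q, hq, hqe⟩ := hpoly i l
      rw [hqe]
      have := ht q (Ideal.subset_span ⟨k i, hk i, hq,
        ⟨(l.comp (LinearMap.proj i) : Module.Dual ℂ (∀ i, A i)),
          Algebra.subset_adjoin ⟨_, rfl⟩⟩, ?_⟩)
      · simpa [MvPolynomial.aeval_eq_eval] using this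
      · ext w
        rw [polyEval_apply, ← hqe w]
        rfl
    simp [hzero v hv]
  choose n hn using hrad
  -- One exponent that serves for all variables, since it dominates each `n i`.
  let K := ∑ i, n i
  have hK : ∀ i, X i ^ K ∈ Ideal.span H := fun i =>
    Ideal.pow_mem_of_pow_mem _ (hn i) (Finset.single_le_sum (fun _ _ => Nat.zero_le _)
      (Finset.mem_univ i))
  let _ : Algebra (polyFun (∀ i, A i)) (polyFun V) := ψ.toRingHom.toAlgebra
  change Module.Finite (polyFun (∀ i, A i)) (polyFun V)
  let θ : MvPolynomial (Fin d) ℂ →ₐ[ℂ] polyFun V :=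
    (polyEval b).codRestrict (polyFun V) fun q => range_polyEval b ▸ ⟨q, rfl⟩
  have hθ : Function.Surjective θ := by
    rintro ⟨f, hf⟩
    rw [← range_polyEval b] at hf
    obtain ⟨q, rfl⟩ := hf
    exact ⟨q, rfl⟩
  let S : Set (Fin d →₀ ℕ) := {α | ∀ i, α i < K}
  have hS : S.Finite := by
    refine (Set.finite_Iic (Finsupp.equivFunOnFinite.symm fun _ => K)).subset fun α hα => ?_
    exact fun i => (hα i).le
  let T : Submodule (polyFun (∀ i, A i)) (polyFun V) :=
    Submodule.span _ ((fun α => θ (monomial α 1)) '' S)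
  -- The preimage of the module spanned by the small monomials. It is only viewed over ℂ, which is
  -- what the graded Nakayama lemma asks for.
  let N : Submodule ℂ (MvPolynomial (Fin d) ℂ) :=
    { carrier := {q | θ q ∈ T}
      add_mem' := fun ha hb => by
        simp only [Set.mem_ofPred_eq, map_add] at *
        exact T.add_mem ha hb
      zero_mem' := by simp
      smul_mem' := fun c q hq => by
        have := T.smul_mem (algebraMap ℂ _ c) hq
        rw [Algebra.smul_def] at this
        simp only [Set.mem_ofPred_eq, map_smul]
        convert! this using 1 }
  have hN : ∀ q, q ∈ N := by
    refine mem_of_homogeneous_generators H (fun f ⟨j, hj, hf, _⟩ => ⟨j, hj, hf⟩) N ?_ K hK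
      fun α hα => Submodule.subset_span ⟨α, hα, rfl⟩
    rintro f ⟨-, -, -, g, hg⟩ q hq
    have hg' : θ f = ψ g := Subtype.ext hg.symm
    have := T.smul_mem g hq
    rw [Algebra.smul_def] at this
    change θ (q * f) ∈ T
    rw [map_mul, hg', mul_comm]
    exact this
  have hT : T = ⊤ := by
    rw [Submodule.eq_top_iff']
    intro f
    obtain ⟨q, rfl⟩ := hθ f
    exact hN q
  exact ⟨hT ▸ Submodule.fg_span (hS.image _)⟩

end Finite

/-! ### Finiteness of spaces of holomorphic sections over a compact surface -/

/-! ### Schwarz-type estimate for functions with vanishing Taylor coefficients. -/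

section Schwarz

variable {M : Type*} [NormedAddCommGroup M] [NormedSpace ℂ M] [CompleteSpace M]

/-- A holomorphic function whose first `N` Taylor coefficients vanish is small on the disc of half
the radius. -/
theorem norm_le_of_cauchyPowerSeries_eq_zero {g : ℂ → M} {c : ℂ} {R : ℝ} (hR : 0 < R)
    (hg : DifferentiableOn ℂ g (Metric.closedBall c R)) {C : ℝ}
    (hC : ∀ z ∈ Metric.sphere c R, ‖g z‖ ≤ C) {N : ℕ}
    (hN : ∀ k < N, cauchyPowerSeries g c R k = 0) {z : ℂ} (hz : z ∈ Metric.closedBall c (R / 2)) :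
    ‖g z‖ ≤ 2 * C * (1 / 2) ^ N := by
  have hC0 : 0 ≤ C := by
    obtain ⟨w, hw⟩ := NormedSpace.sphere_nonempty (x := c) (r := R) |>.2 hR.le
    exact (norm_nonneg _).trans (hC w hw)
  have hint : CircleIntegrable g c R :=
    (hg.continuousOn.mono Metric.sphere_subset_closedBall).circleIntegrable hR.le
  have hzR : ‖z - c‖ ≤ R / 2 := by simpa [dist_eq_norm] using hz
  have hs := hasSum_cauchyPowerSeries_integral hint (w := z - c) (by linarith)
  rw [add_sub_cancel, Complex.two_pi_I_inv_smul_circleIntegral_sub_inv_smul_of_differentiable_on_off_countable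
    Set.countable_empty (by rw [Metric.mem_ball, dist_eq_norm]; linarith) hg.continuousOn
    (fun w hw => (hg.mono Metric.ball_subset_closedBall).differentiableAt
      (Metric.isOpen_ball.mem_nhds hw.1))] at hs
  -- Cauchy's estimate on the circle of radius `R`, evaluated at distance at most R / 2. The terms
  -- of index at least `N` then sum to at most 2C / 2^N.
  have hb : ∀ k, ‖cauchyPowerSeries g c R k fun _ => z - c‖ ≤ C * (1 / 2) ^ k := by
    intro k
    have h1 : ‖cauchyPowerSeries g c R k‖ ≤ C * R⁻¹ ^ k := by
      refine (norm_cauchyPowerSeries_le g c R k).trans ?_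
      rw [abs_of_pos hR]
      gcongr
      have : ∫ θ in (0 : ℝ)..2 * Real.pi, ‖g (circleMap c R θ)‖ ≤
          ∫ θ in (0 : ℝ)..2 * Real.pi, C := by
        refine intervalIntegral.integral_mono_on Real.two_pi_pos.le hint.norm ?_ fun θ _ =>
          hC _ (circleMap_mem_sphere c hR.le θ)
        simp
      rw [intervalIntegral.integral_const, sub_zero, smul_eq_mul] at this
      rw [inv_mul_le_iff₀ Real.two_pi_pos]
      exact this
    refine ((cauchyPowerSeries g c R k).le_opNorm _).trans ?_
    simp only [Finset.prod_const, Finset.card_univ, Fintype.card_fin]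
    calc _ ≤ (C * R⁻¹ ^ k) * (R / 2) ^ k := by gcongr
      _ = C * (1 / 2) ^ k := by
        rw [mul_assoc, ← mul_pow]; congr 2; field_simp
  rw [← hasSum_nat_add_iff' N, Finset.sum_eq_zero, sub_zero] at hs
  · have hgeo := (summable_geometric_two.hasSum.mul_left (C * (1 / 2) ^ N))
    rw [tsum_geometric_two] at hgeo
    have := tsum_of_norm_bounded hgeo (f := fun k => cauchyPowerSeries g c R (k + N) fun _ => z - c)
      fun k => by
        refine (hb (k + N)).trans (le_of_eq ?_)
        rw [pow_add]; ring
    rw [hs.tsum_eq] at this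
    linarith
  · intro k hk
    rw [hN k (Finset.mem_range.1 hk)]
    rfl

end Schwarz

/-! ### Finite-dimensionality by a contraction estimate between circles and half-radius discs. -/

section Finiteness

variable {X : Type*} [TopologicalSpace X]

/-- Local bounds, uniform in a parameter, are uniform on compact sets. -/
theorem exists_uniform_bound {W : Type*} {K : Set X} (hK : IsCompact K) (a b : W → X → ℝ)
    (ha : ∀ w x, 0 ≤ a w x) (h : ∀ x ∈ K, ∃ C : ℝ, ∀ᶠ y in 𝓝 x, ∀ w, b w y ≤ C * a w y) :
    ∃ C : ℝ, 0 ≤ C ∧ ∀ y ∈ K, ∀ w, b w y ≤ C * a w y := by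
  refine hK.induction_on (p := fun S => ∃ C : ℝ, 0 ≤ C ∧ ∀ y ∈ S, ∀ w, b w y ≤ C * a w y)
    ⟨0, le_rfl, by simp⟩ ?_ ?_ ?_
  · rintro s t hst ⟨C, hC, hCt⟩
    exact ⟨C, hC, fun y hy => hCt y (hst hy)⟩
  · rintro s t ⟨C, hC, hCs⟩ ⟨C', hC', hCt⟩
    refine ⟨max C C', le_max_of_le_left hC, ?_⟩
    rintro y (hy | hy) w
    · exact (hCs y hy w).trans (mul_le_mul_of_nonneg_right (le_max_left _ _) (ha w y))
    · exact (hCt y hy w).trans (mul_le_mul_of_nonneg_right (le_max_right _ _) (ha w y))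
  · intro x hx
    obtain ⟨C, hC⟩ := h x hx
    refine ⟨_, mem_nhdsWithin_of_mem_nhds hC, max C 0, le_max_right _ _, fun y hy w => ?_⟩
    exact (hy w).trans (mul_le_mul_of_nonneg_right (le_max_left _ _) (ha w y))

/-- Let `W` be a space of sections over a compact surface, given by compatible local
representatives `F p Φ` on the neighbourhoods `U p`, which are holomorphic (after removing the
singularities at the exceptional points `D`). Then `W` is finite-dimensional. -/
theorem finiteDimensional_of_local_holomorphic [T2Space X] [CompactSpace X] [ChartedSpace ℂ X]
    {W M : Type*} [AddCommGroup W] [Module ℂ W] [NormedAddCommGroup M] [NormedSpace ℂ M]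
    [FiniteDimensional ℂ M] (D : Set X) (U : X → Set X) (hUo : ∀ p, IsOpen (U p))
    (hUp : ∀ p, p ∈ U p) (hUc : ∀ p, U p ⊆ (chartAt ℂ p).source)
    (hUD : ∀ p, ∀ x ∈ U p, x ∈ D → x = p) (F : X → W →ₗ[ℂ] (X → M))
    (hF : ∀ p Φ, ∃ g : ℂ → M, DifferentiableOn ℂ g (chartAt ℂ p '' U p) ∧
      ∀ x ∈ U p, x ∉ D → g (chartAt ℂ p x) = F p Φ x)
    (hC : ∀ p q, ∀ x ∈ U p, x ∈ U q → x ∉ D →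
      ∃ C : ℝ, ∀ᶠ y in 𝓝 x, ∀ Φ, ‖F p Φ y‖ ≤ C * ‖F q Φ y‖)
    (hz : ∀ Φ, (∀ p, ∀ x ∈ U p, x ∉ D → F p Φ x = 0) → Φ = 0) :
    FiniteDimensional ℂ W := by
  have : CompleteSpace M := FiniteDimensional.complete ℂ M
  have hopen : ∀ p, IsOpen (chartAt ℂ p '' U p) := fun p =>
    (chartAt ℂ p).isOpen_image_of_subset_source (hUo p) (hUc p)
  have hR : ∀ p, ∃ R : ℝ, 0 < R ∧ Metric.closedBall (chartAt ℂ p p) R ⊆ chartAt ℂ p '' U p :=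
    fun p => Metric.nhds_basis_closedBall.mem_iff.1
      ((hopen p).mem_nhds (Set.mem_image_of_mem _ (hUp p)))
  choose R hR hRU using hR
  have hRt : ∀ p, Metric.closedBall (chartAt ℂ p p) (R p) ⊆ (chartAt ℂ p).target := fun p =>
    (hRU p).trans (by rintro _ ⟨x, hx, rfl⟩; exact (chartAt ℂ p).map_source (hUc p hx))
  have hsymmU : ∀ p, ∀ z ∈ Metric.closedBall (chartAt ℂ p p) (R p), (chartAt ℂ p).symm z ∈ U p := by
    intro p z hz
    obtain ⟨x, hx, rfl⟩ := hRU p hz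
    rwa [(chartAt ℂ p).left_inv (hUc p hx)]
  choose g hg hgF using hF
  -- small discs and circles
  let k : X → Set X := fun p => (chartAt ℂ p).symm '' Metric.closedBall (chartAt ℂ p p) (R p / 2)
  let S : X → Set X := fun p => (chartAt ℂ p).symm '' Metric.sphere (chartAt ℂ p p) (R p)
  have hhalf : ∀ p, Metric.closedBall (chartAt ℂ p p) (R p / 2) ⊆
      Metric.closedBall (chartAt ℂ p p) (R p) := fun p =>
    Metric.closedBall_subset_closedBall (by linarith [hR p])
  have hkU : ∀ p, k p ⊆ U p := by
    rintro p _ ⟨z, hz, rfl⟩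
    exact hsymmU p z (hhalf p hz)
  have hSU : ∀ p, S p ⊆ U p := by
    rintro p _ ⟨z, hz, rfl⟩
    exact hsymmU p z (Metric.sphere_subset_closedBall hz)
  -- The only point of `D` that `U p` can contain is the centre `p`, which is not on the circle.
  have hSD : ∀ p, ∀ x ∈ S p, x ∉ D := by
    rintro p _ ⟨z, hz, rfl⟩ hD
    have h1 := hUD p _ (hsymmU p z (Metric.sphere_subset_closedBall hz)) hD
    have h2 := (chartAt ℂ p).right_inv (hRt p (Metric.sphere_subset_closedBall hz))
    rw [h1] at h2
    rw [← h2, Metric.mem_sphere, dist_self] at hz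
    exact (hR p).ne hz
  have hkcompact : ∀ p, IsCompact (k p) := fun p =>
    (isCompact_closedBall _ _).image_of_continuousOn
      ((chartAt ℂ p).continuousOn_symm.mono ((hhalf p).trans (hRt p)))
  have hScompact : ∀ p, IsCompact (S p) := fun p =>
    (isCompact_sphere _ _).image_of_continuousOn
      ((chartAt ℂ p).continuousOn_symm.mono (Metric.sphere_subset_closedBall.trans (hRt p)))
  have hknhds : ∀ p, k p ∈ 𝓝 p := by
    intro p
    have := (chartAt ℂ p).symm.image_mem_nhds (x := chartAt ℂ p p) (by simp)
      (Metric.closedBall_mem_nhds _ (half_pos (hR p)))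
    simpa using this
  obtain ⟨T, -, hT⟩ := isCompact_univ.elim_nhds_subcover k fun p _ => hknhds p
  have hcover : ∀ x, ∃ q ∈ T, x ∈ k q := by
    intro x
    simpa using hT (Set.mem_univ x)
  have hbound : ∀ p q, ∃ C : ℝ, 0 ≤ C ∧ ∀ y ∈ S p ∩ k q, ∀ Φ, ‖F p Φ y‖ ≤ C * ‖F q Φ y‖ :=
    fun p q => exists_uniform_bound ((hScompact p).inter (hkcompact q))
      (fun Φ y => ‖F q Φ y‖) (fun Φ y => ‖F p Φ y‖) (fun _ _ => norm_nonneg _)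
      fun x hx => hC p q x (hSU p hx.1) (hkU q hx.2) (hSD p x hx.1)
  choose B hB0 hB using hbound
  let C : ℝ := ∑ p ∈ T, ∑ q ∈ T, B p q
  have hBC : ∀ p ∈ T, ∀ q ∈ T, B p q ≤ C := fun p hp q hq =>
    (Finset.single_le_sum (f := fun q => B p q) (fun q _ => hB0 p q) hq).trans
      (Finset.single_le_sum (f := fun p => ∑ q ∈ T, B p q)
        (fun p _ => Finset.sum_nonneg fun q _ => hB0 p q) hp)
  -- `C` bounds every comparison of local representatives within the finite cover. This choice of
  -- `N` makes the Schwarz gain outweigh that loss.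
  obtain ⟨N, hN⟩ : ∃ N : ℕ, 2 * C * (1 / 2) ^ N < 1 := by
    have := (tendsto_pow_atTop_nhds_zero_of_lt_one (r := (1 / 2 : ℝ)) (by norm_num)
      (by norm_num)).const_mul (2 * C)
    rw [mul_zero] at this
    exact (this.eventually (gt_mem_nhds one_pos)).exists
  -- the Taylor coefficients at the centres
  have hsph : ∀ p Φ, ∀ z ∈ Metric.sphere (chartAt ℂ p p) (R p),
      F p Φ ((chartAt ℂ p).symm z) = g p Φ z := by
    intro p Φ z hz
    have h1 : (chartAt ℂ p).symm z ∈ S p := Set.mem_image_of_mem _ hz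
    rw [← hgF p Φ _ (hSU p h1) (hSD p _ h1),
      (chartAt ℂ p).right_inv (hRt p (Metric.sphere_subset_closedBall hz))]
  have hcont : ∀ p Φ (j : ℕ), ContinuousOn (fun z => (z - chartAt ℂ p p)⁻¹ ^ j •
      (z - chartAt ℂ p p)⁻¹ • F p Φ ((chartAt ℂ p).symm z))
      (Metric.sphere (chartAt ℂ p p) (R p)) := by
    intro p Φ j
    have h1 : ContinuousOn (fun z => F p Φ ((chartAt ℂ p).symm z))
        (Metric.sphere (chartAt ℂ p p) (R p)) :=
      ((hg p Φ).continuousOn.mono (Metric.sphere_subset_closedBall.trans (hRU p))).congr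
        (hsph p Φ)
    have h2 : ContinuousOn (fun z => (z - chartAt ℂ p p)⁻¹)
        (Metric.sphere (chartAt ℂ p p) (R p)) := by
      refine ContinuousOn.inv₀ (by fun_prop) fun z hz h0 => ?_
      rw [mem_sphere_iff_norm, h0, norm_zero] at hz
      exact (hR p).ne hz
    exact (h2.pow j).smul (h2.smul h1)
  -- The first `N` Taylor coefficients at the finitely many centres, up to the factor 2πi. The
  -- integrals use `F`, which is linear in `Φ`; the extensions `g` were chosen separately for each
  -- `Φ`. The two agree on the circles.
  let J : W →ₗ[ℂ] (T × Fin N → M) :=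
    { toFun := fun Φ i => ∮ z in C(chartAt ℂ (i.1 : X) i.1, R i.1),
        (z - chartAt ℂ (i.1 : X) i.1)⁻¹ ^ (i.2 : ℕ) •
          (z - chartAt ℂ (i.1 : X) i.1)⁻¹ • F i.1 Φ ((chartAt ℂ (i.1 : X)).symm z)
      map_add' := fun Φ Φ' => by
        funext i
        simp only [map_add, Pi.add_apply, smul_add]
        exact circleIntegral.integral_add ((hcont _ Φ _).circleIntegrable (hR _).le)
          ((hcont _ Φ' _).circleIntegrable (hR _).le)
      map_smul' := fun c Φ => by
        funext i
        simp only [map_smul, Pi.smul_apply, RingHom.id_apply]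
        refine Eq.trans ?_ (circleIntegral.integral_smul c _ _ _)
        congr 1
        funext z
        rw [smul_comm _ c, smul_comm _ c] }
  refine FiniteDimensional.of_injective J ((injective_iff_map_eq_zero J).2 fun Φ hΦ => ?_)
  have hcoef : ∀ p ∈ T, ∀ j < N, cauchyPowerSeries (g p Φ) (chartAt ℂ p p) (R p) j = 0 := by
    intro p hp j hj
    have h1 : (∮ z in C(chartAt ℂ p p, R p), (z - chartAt ℂ p p)⁻¹ ^ j •
        (z - chartAt ℂ p p)⁻¹ • F p Φ ((chartAt ℂ p).symm z)) = 0 :=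
      congrFun hΦ (⟨p, hp⟩, ⟨j, hj⟩)
    have h2 : (∮ z in C(chartAt ℂ p p, R p), (z - chartAt ℂ p p)⁻¹ ^ j •
        (z - chartAt ℂ p p)⁻¹ • g p Φ z) = 0 := by
      refine Eq.trans ?_ h1
      refine circleIntegral.integral_congr (hR p).le fun z hz => ?_
      rw [hsph p Φ z hz]
    rw [cauchyPowerSeries, h2, smul_zero]
    ext
    simp
  have hgball : ∀ p, DifferentiableOn ℂ (g p Φ) (Metric.closedBall (chartAt ℂ p p) (R p)) :=
    fun p => (hg p Φ).mono (hRU p)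
  have hsmall : ∀ A : ℝ, (∀ q ∈ T, ∀ y ∈ S q, ‖F q Φ y‖ ≤ A) → ∀ q ∈ T, ∀ y ∈ k q, y ∉ D →
      ‖F q Φ y‖ ≤ 2 * A * (1 / 2) ^ N := by
    rintro A hA q hq _ ⟨z, hz, rfl⟩ hy
    rw [← hgF q Φ _ (hkU q (Set.mem_image_of_mem _ hz)) hy,
      (chartAt ℂ q).right_inv (hRt q (hhalf q hz))]
    refine norm_le_of_cauchyPowerSeries_eq_zero (hR q) (hgball q) (fun w hw => ?_) (hcoef q hq) hz
    rw [← hsph q Φ w hw]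
    exact hA q hq _ (Set.mem_image_of_mem _ hw)
  -- Each point of a circle lies in some half-radius disc. Comparing representatives there and
  -- applying the Schwarz estimate shrinks any common bound on the circles by a factor below 1;
  -- iteration forces the bound 0.
  have hstep : ∀ A : ℝ, (∀ q ∈ T, ∀ y ∈ S q, ‖F q Φ y‖ ≤ A) →
      ∀ q ∈ T, ∀ y ∈ S q, ‖F q Φ y‖ ≤ 2 * C * (1 / 2) ^ N * A := by
    intro A hA p hp y hy
    obtain ⟨q, hq, hyq⟩ := hcover y
    calc ‖F p Φ y‖ ≤ B p q * ‖F q Φ y‖ := hB p q y ⟨hy, hyq⟩ Φ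
      _ ≤ C * (2 * A * (1 / 2) ^ N) := by
        refine mul_le_mul (hBC p hp q hq) (hsmall A hA q hq y hyq (hSD p y hy)) (norm_nonneg _)
          ((hB0 p q).trans (hBC p hp q hq))
      _ = 2 * C * (1 / 2) ^ N * A := by ring
  obtain ⟨A, hA⟩ : ∃ A : ℝ, ∀ q ∈ T, ∀ y ∈ S q, ‖F q Φ y‖ ≤ A := by
    have : ∀ q, ∃ A : ℝ, 0 ≤ A ∧ ∀ y ∈ S q, ‖F q Φ y‖ ≤ A := by
      intro q
      obtain ⟨A, hA⟩ := (isCompact_sphere (chartAt ℂ q q) (R q)).exists_bound_of_continuousOn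
        ((hgball q).continuousOn.mono Metric.sphere_subset_closedBall)
      refine ⟨max A 0, le_max_right _ _, ?_⟩
      rintro _ ⟨z, hz, rfl⟩
      rw [hsph q Φ z hz]
      exact (hA z hz).trans (le_max_left _ _)
    choose A hA0 hA using this
    exact ⟨∑ q ∈ T, A q, fun q hq y hy => (hA q y hy).trans
      (Finset.single_le_sum (fun q _ => hA0 q) hq)⟩
  have hzero : ∀ q ∈ T, ∀ y ∈ S q, ‖F q Φ y‖ ≤ 0 := by
    have hpow : ∀ n : ℕ, ∀ q ∈ T, ∀ y ∈ S q, ‖F q Φ y‖ ≤ (2 * C * (1 / 2) ^ N) ^ n * A := by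
      intro n
      induction n with
      | zero => simpa using hA
      | succ n ih =>
        intro q hq y hy
        refine (hstep _ ih q hq y hy).trans (le_of_eq ?_)
        rw [pow_succ]; ring
    have hC0 : 0 ≤ C := Finset.sum_nonneg fun p _ => Finset.sum_nonneg fun q _ => hB0 p q
    intro q hq y hy
    have := (tendsto_pow_atTop_nhds_zero_of_lt_one (by positivity) hN).mul_const A
    rw [zero_mul] at this
    exact ge_of_tendsto' this fun n => hpow n q hq y hy
  -- Vanishing on the circles gives vanishing on the half-radius discs off `D`. These cover the
  -- surface, and the comparison carries the vanishing to every other representative.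
  refine hz Φ fun p x hx hxD => ?_
  obtain ⟨q, hq, hxq⟩ := hcover x
  obtain ⟨c, hc⟩ := hC p q x hx (hkU q hxq) hxD
  have h1 := hsmall 0 hzero q hq x hxq hxD
  have h2 : F q Φ x = 0 := by simpa using h1
  have h3 := hc.self_of_nhds Φ
  rw [h2, norm_zero, mul_zero] at h3
  simpa using h3

end Finiteness

/-! ### Local representatives of Higgs fields -/

section Coordinates

variable {X : Type*} [TopologicalSpace X] [ChartedSpace ℂ X] [IsManifold 𝓘(ℂ) ω X]

theorem contMDiffAt_chartAt {p x : X} (hx : x ∈ (chartAt ℂ p).source) :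
    ContMDiffAt 𝓘(ℂ) 𝓘(ℂ) ω (chartAt ℂ p) x :=
  (contMDiffOn_chart (I := 𝓘(ℂ)) (x := p)).contMDiffAt ((chartAt ℂ p).open_source.mem_nhds hx)

theorem contMDiffAt_chartAt_symm {p x : X} (hx : x ∈ (chartAt ℂ p).source) :
    ContMDiffAt 𝓘(ℂ) 𝓘(ℂ) ω (chartAt ℂ p).symm (chartAt ℂ p x) :=
  (contMDiffOn_chart_symm (I := 𝓘(ℂ)) (x := p)).contMDiffAt
    ((chartAt ℂ p).open_target.mem_nhds ((chartAt ℂ p).map_source hx))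

theorem contMDiffAt_coordAt {p x : X} (hx : x ∈ (chartAt ℂ p).source) :
    ContMDiffAt 𝓘(ℂ) 𝓘(ℂ) ω (coordAt p) x :=
  (contMDiffAt_chartAt hx).sub contMDiffAt_const

/-- The derivative at `x` of the change of coordinates from the chart at `p` to the chart at `q`. -/
def transitionDeriv (p q x : X) : ℂ :=
  deriv (fun z => chartAt ℂ q ((chartAt ℂ p).symm z)) (chartAt ℂ p x)

theorem analyticAt_transition {p q x : X} (hp : x ∈ (chartAt ℂ p).source)
    (hq : x ∈ (chartAt ℂ q).source) :
    AnalyticAt ℂ (fun z => chartAt ℂ q ((chartAt ℂ p).symm z)) (chartAt ℂ p x) := by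
  refine ContDiffAt.analyticAt (contMDiffAt_iff_contDiffAt.1 ?_)
  refine ContMDiffAt.comp (chartAt ℂ p x) ?_ (contMDiffAt_chartAt_symm hp)
  rw [(chartAt ℂ p).left_inv hp]
  exact contMDiffAt_chartAt hq

theorem contMDiffAt_transitionDeriv {p q x : X} (hp : x ∈ (chartAt ℂ p).source)
    (hq : x ∈ (chartAt ℂ q).source) :
    ContMDiffAt 𝓘(ℂ) 𝓘(ℂ) ω (transitionDeriv p q) x :=
  (analyticAt_transition hp hq).deriv.contDiffAt.contMDiffAt.comp x (contMDiffAt_chartAt hp)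

/-- The differential at `x` of the chart at `p`. -/
def chartDifferential (p x : X) (v : TangentSpace 𝓘(ℂ) x) : ℂ :=
  mfderiv 𝓘(ℂ) 𝓘(ℂ) (chartAt ℂ p) x v

theorem dcoordAt_eq_mul_chartDifferential {p q x : X} (hp : x ∈ (chartAt ℂ p).source)
    (hq : x ∈ (chartAt ℂ q).source) (v : TangentSpace 𝓘(ℂ) x) :
    dcoordAt q x v = transitionDeriv p q x * chartDifferential p x v := by
  have h1 : coordAt q =ᶠ[𝓝 x]
      (fun z => chartAt ℂ q ((chartAt ℂ p).symm z) - chartAt ℂ q q) ∘ chartAt ℂ p := by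
    filter_upwards [(chartAt ℂ p).open_source.mem_nhds hp] with y hy
    simp [coordAt, (chartAt ℂ p).left_inv hy]
  have h2 : HasDerivAt (fun z => chartAt ℂ q ((chartAt ℂ p).symm z) - chartAt ℂ q q)
      (transitionDeriv p q x) (chartAt ℂ p x) :=
    (analyticAt_transition hp hq).differentiableAt.hasDerivAt.sub_const _
  have h3 : HasMFDerivAt 𝓘(ℂ) 𝓘(ℂ) (chartAt ℂ p) x (mfderiv 𝓘(ℂ) 𝓘(ℂ) (chartAt ℂ p) x) :=
    ((contMDiffAt_chartAt hp).mdifferentiableAt (by simp)).hasMFDerivAt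
  have h4 := (h2.hasFDerivAt.hasMFDerivAt.comp x h3).congr_of_eventuallyEq h1
  rw [dcoordAt, h4.mfderiv]
  exact mul_comm _ _

theorem transitionDeriv_self {p x : X} (hp : x ∈ (chartAt ℂ p).source) :
    transitionDeriv p p x = 1 := by
  have : (fun z => chartAt ℂ p ((chartAt ℂ p).symm z)) =ᶠ[𝓝 (chartAt ℂ p x)] id := by
    filter_upwards [(chartAt ℂ p).open_target.mem_nhds ((chartAt ℂ p).map_source hp)] with z hz
    exact (chartAt ℂ p).right_inv hz
  rw [transitionDeriv, this.deriv_eq, deriv_id]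

theorem dcoordAt_eq_mul {p q x : X} (hp : x ∈ (chartAt ℂ p).source)
    (hq : x ∈ (chartAt ℂ q).source) (v : TangentSpace 𝓘(ℂ) x) :
    dcoordAt q x v = transitionDeriv p q x * dcoordAt p x v := by
  rw [dcoordAt_eq_mul_chartDifferential hp hq, dcoordAt_eq_mul_chartDifferential hp hp, transitionDeriv_self hp,
    one_mul]

/-- The tangent vector at `x` represented by `1` in the preferred chart at `x`. -/
def unitVector (x : X) : TangentSpace 𝓘(ℂ) x := (1 : ℂ)

/-- The tangent space unfolds to ℂ, so a Higgs field is determined by its values on these vectors.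
-/
theorem eq_smul_unitVector {X : Type*} [TopologicalSpace X] [ChartedSpace ℂ X] {x : X} (v : TangentSpace 𝓘(ℂ) x) :
    ∃ c : ℂ, v = c • unitVector x := ⟨v, (mul_one (M := ℂ) v).symm⟩

/-- In the preferred chart at `x` the differential is 1 on this vector, and the chain rule factors
that 1 through the chart at `p`. -/
theorem dcoordAt_unitVector_ne_zero {p x : X} (hp : x ∈ (chartAt ℂ p).source) :
    dcoordAt p x (unitVector x) ≠ 0 := by
  have h1 : dcoordAt x x (unitVector x) = 1 := by
    rw [dcoordAt_eq_mul_chartDifferential (mem_chart_source ℂ x) (mem_chart_source ℂ x),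
      transitionDeriv_self (mem_chart_source ℂ x), one_mul, chartDifferential,
      mfderiv_chartAt_eq_tangentCoordChange (mem_chart_source ℂ x)]
    exact tangentCoordChange_self (I := 𝓘(ℂ)) (by simp)
  rw [dcoordAt_eq_mul hp (mem_chart_source ℂ x)] at h1
  exact right_ne_zero_of_mul_eq_one h1

end Coordinates

/-! ### Fibre endomorphisms in local trivializations. -/

section InCoordinates

variable {X : Type*} [TopologicalSpace X] {n : ℕ} {E : X → Type*}
  [∀ x, AddCommGroup (E x)] [∀ x, Module ℂ (E x)] [∀ x, TopologicalSpace (E x)]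
  [TopologicalSpace (TotalSpace (Fin n → ℂ) E)] [FiberBundle (Fin n → ℂ) E]
  [VectorBundle ℂ (Fin n → ℂ) E]

/-- The matrix of an endomorphism of the fibre at `x` in the trivialization at `p`. -/
def endCoord (n : ℕ) {E : X → Type*}
    [∀ x, AddCommGroup (E x)] [∀ x, Module ℂ (E x)] [∀ x, TopologicalSpace (E x)]
    [TopologicalSpace (TotalSpace (Fin n → ℂ) E)] [FiberBundle (Fin n → ℂ) E]
    [VectorBundle ℂ (Fin n → ℂ) E] (p : X) {x : X} (A : E x →L[ℂ] E x) :
    (Fin n → ℂ) →L[ℂ] (Fin n → ℂ) :=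
  ContinuousLinearMap.inCoordinates (Fin n → ℂ) E (Fin n → ℂ) E p x p x A

/-- The change of trivialization from `p` to `q` at `x`. -/
def trivChange (n : ℕ) (E : X → Type*)
    [∀ x, AddCommGroup (E x)] [∀ x, Module ℂ (E x)] [∀ x, TopologicalSpace (E x)]
    [TopologicalSpace (TotalSpace (Fin n → ℂ) E)] [FiberBundle (Fin n → ℂ) E]
    [VectorBundle ℂ (Fin n → ℂ) E] (p q x : X) : (Fin n → ℂ) →L[ℂ] (Fin n → ℂ) :=
  (trivializationAt (Fin n → ℂ) E p).coordChangeL ℂ (trivializationAt (Fin n → ℂ) E q) x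

theorem trivChange_apply {p q x : X} (hp : x ∈ (trivializationAt (Fin n → ℂ) E p).baseSet)
    (hq : x ∈ (trivializationAt (Fin n → ℂ) E q).baseSet) (v : Fin n → ℂ) :
    trivChange n E p q x v = (trivializationAt (Fin n → ℂ) E q).continuousLinearEquivAt ℂ x hq
      (((trivializationAt (Fin n → ℂ) E p).continuousLinearEquivAt ℂ x hp).symm v) :=
  Trivialization.coordChangeL_apply _ _ ⟨hp, hq⟩ v

theorem endCoord_change {p q x : X} (hp : x ∈ (trivializationAt (Fin n → ℂ) E p).baseSet)
    (hq : x ∈ (trivializationAt (Fin n → ℂ) E q).baseSet) (A : E x →L[ℂ] E x) :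
    endCoord n p A =
      (trivChange n E q p x).comp ((endCoord n q A).comp (trivChange n E p q x)) := by
  ext v : 1
  rw [endCoord, endCoord, ContinuousLinearMap.inCoordinates_eq hp hp,
    ContinuousLinearMap.inCoordinates_eq hq hq]
  simp only [ContinuousLinearMap.comp_apply, ContinuousLinearEquiv.coe_coe,
    trivChange_apply hp hq, trivChange_apply hq hp, ContinuousLinearEquiv.symm_apply_apply]

theorem endCoord_injective {p x : X} (hp : x ∈ (trivializationAt (Fin n → ℂ) E p).baseSet)
    {A : E x →L[ℂ] E x} (hA : endCoord n p A = 0) : A = 0 := by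
  rw [endCoord, ContinuousLinearMap.inCoordinates_eq hp hp] at hA
  ext u
  have := DFunLike.congr_fun hA
    ((trivializationAt (Fin n → ℂ) E p).continuousLinearEquivAt ℂ x hp u)
  simp only [ContinuousLinearMap.comp_apply, ContinuousLinearEquiv.coe_coe,
    ContinuousLinearEquiv.symm_apply_apply, zero_apply,
    ContinuousLinearEquiv.map_eq_zero_iff] at this
  exact this

variable [∀ x, IsTopologicalAddGroup (E x)] [∀ x, ContinuousSMul ℂ (E x)]

theorem endCoord_smul (p : X) {x : X} (c : ℂ) (A : E x →L[ℂ] E x) :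
    endCoord n p (c • A) = c • endCoord n p A := by
  ext v : 1
  simp only [endCoord, ContinuousLinearMap.inCoordinates, ContinuousLinearMap.comp_apply,
    smul_apply, map_smul]

theorem endCoord_add (p : X) {x : X} (A B : E x →L[ℂ] E x) :
    endCoord n p (A + B) = endCoord n p A + endCoord n p B := by
  ext v : 1
  simp only [endCoord, ContinuousLinearMap.inCoordinates, ContinuousLinearMap.comp_apply,
    add_apply, map_add]

end InCoordinates

/-! ### Holomorphic representatives of Higgs fields and finite-dimensionality of their space. -/

section HiggsFields

variable {X : Type*} [TopologicalSpace X] [ChartedSpace ℂ X] [IsManifold 𝓘(ℂ) ω X]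
  {D : Finset X} {n : ℕ} {E : X → Type*}
  [∀ x, AddCommGroup (E x)] [∀ x, Module ℂ (E x)] [∀ x, TopologicalSpace (E x)]
  [∀ x, IsTopologicalAddGroup (E x)] [∀ x, ContinuousSMul ℂ (E x)]
  [TopologicalSpace (TotalSpace (Fin n → ℂ) E)] [FiberBundle (Fin n → ℂ) E]
  [VectorBundle ℂ (Fin n → ℂ) E] [ContMDiffVectorBundle ω (Fin n → ℂ) E 𝓘(ℂ)]
  {L : X → Type*}
  [∀ x, AddCommGroup (L x)] [∀ x, Module ℂ (L x)] [∀ x, TopologicalSpace (L x)]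
  [∀ x, IsTopologicalAddGroup (L x)] [∀ x, ContinuousSMul ℂ (L x)]
  [TopologicalSpace (TotalSpace ℂ L)] [FiberBundle ℂ L] [VectorBundle ℂ ℂ L]

theorem contMDiffAt_trivChange {p q x : X}
    (hp : x ∈ (trivializationAt (Fin n → ℂ) E p).baseSet)
    (hq : x ∈ (trivializationAt (Fin n → ℂ) E q).baseSet) :
    ContMDiffAt 𝓘(ℂ) 𝓘(ℂ, (Fin n → ℂ) →L[ℂ] (Fin n → ℂ)) ω (trivChange n E p q) x :=
  contMDiffAt_coordChangeL hp hq

/-- A neighbourhood of `p` carrying a chart of `X` and a trivialization of `E`, and containing no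
point of `D` but possibly `p`. -/
def chartNhd (D : Finset X) (n : ℕ) (E : X → Type*) [∀ x, TopologicalSpace (E x)]
    [TopologicalSpace (TotalSpace (Fin n → ℂ) E)] [FiberBundle (Fin n → ℂ) E] (p : X) : Set X :=
  ((chartAt ℂ p).source ∩ (trivializationAt (Fin n → ℂ) E p).baseSet) \ ((D : Set X) \ {p})

open Classical in
/-- A generator near `p` of the line bundle `𝒪(-D)`. -/
def poleFactor (D : Finset X) (p x : X) : ℂ := if p ∈ D then coordAt p x else 1

theorem contMDiffAt_poleFactor {p x : X} (hx : x ∈ (chartAt ℂ p).source) :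
    ContMDiffAt 𝓘(ℂ) 𝓘(ℂ) ω (poleFactor D p) x := by
  unfold poleFactor
  split_ifs
  · exact contMDiffAt_coordAt hx
  · exact contMDiffAt_const

theorem poleFactor_ne_zero {p x : X} (hx : x ∈ (chartAt ℂ p).source) (hD : x ∉ D) :
    poleFactor D p x ≠ 0 := by
  unfold poleFactor
  split_ifs with hp
  · intro h
    have := (chartAt ℂ p).injOn hx (mem_chart_source ℂ p) (sub_eq_zero.1 h)
    exact hD (this ▸ hp)
  · exact one_ne_zero

/-- The matrix in the trivialization at `p` of the coefficient of a Higgs field with respect to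
`dz` or `dz / z`, where `z` is the coordinate centred at `p`. -/
def higgsCoord (D : Finset X) (n : ℕ) {E : X → Type*}
    [∀ x, AddCommGroup (E x)] [∀ x, Module ℂ (E x)] [∀ x, TopologicalSpace (E x)]
    [∀ x, IsTopologicalAddGroup (E x)] [∀ x, ContinuousSMul ℂ (E x)]
    [TopologicalSpace (TotalSpace (Fin n → ℂ) E)] [FiberBundle (Fin n → ℂ) E]
    [VectorBundle ℂ (Fin n → ℂ) E] (p : X)
    (Φ : ∀ x : X, TangentSpace 𝓘(ℂ) x →ₗ[ℂ] (E x →L[ℂ] E x)) (x : X) :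
    (Fin n → ℂ) →L[ℂ] (Fin n → ℂ) :=
  (poleFactor D p x / dcoordAt p x (unitVector x)) • endCoord n p (Φ x (unitVector x))

/-- Near a point where a Higgs field is `dz ⊗ Ψ`. -/
theorem higgsCoord_eq_of_eq {p q x : X} (hp : x ∈ (chartAt ℂ p).source)
    (hpE : x ∈ (trivializationAt (Fin n → ℂ) E p).baseSet) (hq : x ∈ (chartAt ℂ q).source)
    (hqE : x ∈ (trivializationAt (Fin n → ℂ) E q).baseSet)
    {Φ : ∀ x : X, TangentSpace 𝓘(ℂ) x →ₗ[ℂ] (E x →L[ℂ] E x)} {A : E x →L[ℂ] E x} 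
    (h : ∀ v, Φ x v = dcoordAt q x v • A) :
    higgsCoord D n p Φ x = (poleFactor D p x * transitionDeriv p q x) •
      (trivChange n E q p x).comp ((endCoord n q A).comp (trivChange n E p q x)) := by
  rw [higgsCoord, h, endCoord_smul p, smul_smul, dcoordAt_eq_mul hp hq,
    endCoord_change hpE hqE]
  congr 1
  have := dcoordAt_unitVector_ne_zero hp
  field_simp

/-- The transition data do not depend on `Φ` and are continuous off `D`, which yields the uniform
comparison of representatives needed for finite-dimensionality. -/
theorem higgsCoord_change {p q x : X} (hp : x ∈ (chartAt ℂ p).source)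
    (hpE : x ∈ (trivializationAt (Fin n → ℂ) E p).baseSet) (hq : x ∈ (chartAt ℂ q).source)
    (hqE : x ∈ (trivializationAt (Fin n → ℂ) E q).baseSet) (hD : x ∉ D)
    (Φ : ∀ x : X, TangentSpace 𝓘(ℂ) x →ₗ[ℂ] (E x →L[ℂ] E x)) :
    higgsCoord D n p Φ x = (poleFactor D p x * transitionDeriv p q x / poleFactor D q x) •
      (trivChange n E q p x).comp ((higgsCoord D n q Φ x).comp (trivChange n E p q x)) := by
  rw [higgsCoord, higgsCoord, endCoord_change hpE hqE, ContinuousLinearMap.smul_comp,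
    ContinuousLinearMap.comp_smul, smul_smul]
  congr 1
  have h1 := dcoordAt_unitVector_ne_zero hp
  have h2 := dcoordAt_unitVector_ne_zero hq
  have h3 := poleFactor_ne_zero (p := q) hq hD
  have h4 := dcoordAt_eq_mul hp hq (unitVector x)
  rw [h4] at h2 ⊢
  have h5 := left_ne_zero_of_mul h2
  field_simp

theorem eventually_notMem_of_notMem [T1Space X] {x : X} (hx : x ∉ D) : ∀ᶠ y in 𝓝 x, y ∉ D :=
  D.finite_toSet.isClosed.isOpen_compl.mem_nhds hx

theorem isOpen_chartNhd [T1Space X] (p : X) : IsOpen (chartNhd D n E p) :=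
  ((chartAt ℂ p).open_source.inter (trivializationAt (Fin n → ℂ) E p).open_baseSet).sdiff
    (D.finite_toSet.subset Set.sdiff_subset).isClosed

theorem eq_of_mem_chartNhd {p x : X} (hx : x ∈ chartNhd D n E p) (hD : x ∈ D) : x = p := by
  by_contra h
  exact hx.2 ⟨hD, h⟩

/-- The local representative of a Higgs field extends holomorphically. -/
theorem exists_contMDiffAt_higgsCoord [T1Space X] {B : SymplecticParabolic D n E L}
    {Φ : ∀ x : X, TangentSpace 𝓘(ℂ) x →ₗ[ℂ] (E x →L[ℂ] E x)} (hΦ : Φ ∈ B.higgsFields) (p : X) :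
    ∃ G : X → ((Fin n → ℂ) →L[ℂ] (Fin n → ℂ)),
      (∀ x ∈ chartNhd D n E p,
        ContMDiffAt 𝓘(ℂ) 𝓘(ℂ, (Fin n → ℂ) →L[ℂ] (Fin n → ℂ)) ω G x) ∧
      ∀ x ∈ chartNhd D n E p, x ∉ D → G x = higgsCoord D n p Φ x := by
  classical
  obtain ⟨-, h2, h3, -⟩ := hΦ
  -- Off `D` the local form of `Φ` is given in the chart and trivialization centred at `x`, so it is
  -- transported from there to those at `p`.
  have regular : ∀ x ∈ chartNhd D n E p, x ∉ D →
      ContMDiffAt 𝓘(ℂ) 𝓘(ℂ, (Fin n → ℂ) →L[ℂ] (Fin n → ℂ)) ω (higgsCoord D n p Φ) x := by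
    intro x hx hxD
    obtain ⟨Ψ, hΨ, h⟩ := h2 x hxD
    have hxE := FiberBundle.mem_baseSet_trivializationAt' (F := Fin n → ℂ) (E := E) x
    have hΨ' : ContMDiffAt 𝓘(ℂ) 𝓘(ℂ, (Fin n → ℂ) →L[ℂ] (Fin n → ℂ)) ω
        (fun y => endCoord n x (Ψ y)) x := ((contMDiffAt_hom_bundle _).1 hΨ).2
    refine (((contMDiffAt_poleFactor (D := D) hx.1.1).mul
      (contMDiffAt_transitionDeriv hx.1.1 (mem_chart_source ℂ x))).smul
      ((contMDiffAt_trivChange hxE hx.1.2).clm_comp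
        (hΨ'.clm_comp (contMDiffAt_trivChange hx.1.2 hxE)))).congr_of_eventuallyEq ?_
    filter_upwards [h, (isOpen_chartNhd p).mem_nhds hx,
      (chartAt ℂ x).open_source.mem_nhds (mem_chart_source ℂ x),
      (trivializationAt (Fin n → ℂ) E x).open_baseSet.mem_nhds hxE] with y hy hyp hyx hyE
    exact higgsCoord_eq_of_eq hyp.1.1 hyp.1.2 hyx hyE hy
  by_cases hp : p ∈ D
  · obtain ⟨Ψ, hΨ, -, h⟩ := h3 p hp
    have hΨ' : ContMDiffAt 𝓘(ℂ) 𝓘(ℂ, (Fin n → ℂ) →L[ℂ] (Fin n → ℂ)) ω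
        (fun y => endCoord n p (Ψ y)) p := ((contMDiffAt_hom_bundle _).1 hΨ).2
    -- The value of `Φ` at a point of `D` is 0 by convention and carries no information; the
    -- coefficient `Ψ` of dz / z supplies the correct value at `p`.
    refine ⟨fun x => if x ∈ D then endCoord n p (Ψ x) else higgsCoord D n p Φ x, ?_,
      fun x _ hxD => if_neg hxD⟩
    intro x hx
    by_cases hxD : x ∈ D
    · obtain rfl := eq_of_mem_chartNhd hx hxD
      refine hΨ'.congr_of_eventuallyEq ?_
      filter_upwards [eventually_nhdsWithin_iff.1 h, (isOpen_chartNhd x).mem_nhds hx] with y hy hyp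
      split_ifs with hyD
      · rfl
      · have hyx : y ≠ x := fun h => hyD (h ▸ hxD)
        have hd := dcoordAt_unitVector_ne_zero hyp.1.1
        rw [higgsCoord, div_eq_inv_mul, mul_smul, ← endCoord_smul, poleFactor, if_pos hxD,
          hy hyx, endCoord_smul, smul_smul, inv_mul_cancel₀ hd, one_smul]
    · refine (regular x hx hxD).congr_of_eventuallyEq ?_
      filter_upwards [eventually_notMem_of_notMem hxD] with y hy
      rw [if_neg hy]
  · refine ⟨higgsCoord D n p Φ, fun x hx => regular x hx fun hxD => hp ?_, fun _ _ _ => rfl⟩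
    rwa [← eq_of_mem_chartNhd hx hxD]

theorem finiteDimensional_higgsFields [T2Space X] [CompactSpace X]
    (B : SymplecticParabolic D n E L) : FiniteDimensional ℂ B.higgsFields := by
  classical
  have hUp : ∀ p, p ∈ chartNhd D n E p := fun p =>
    ⟨⟨mem_chart_source ℂ p, FiberBundle.mem_baseSet_trivializationAt' p⟩, fun h => h.2 rfl⟩
  let F : X → B.higgsFields →ₗ[ℂ] (X → ((Fin n → ℂ) →L[ℂ] (Fin n → ℂ))) := fun p =>
    { toFun := fun Φ => higgsCoord D n p Φ.1
      map_add' := fun Φ Φ' => by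
        funext x
        simp only [higgsCoord, Submodule.coe_add, Pi.add_apply, LinearMap.add_apply, endCoord_add,
          smul_add]
      map_smul' := fun c Φ => by
        funext x
        simp only [higgsCoord, Submodule.coe_smul, Pi.smul_apply, LinearMap.smul_apply,
          endCoord_smul, RingHom.id_apply]
        rw [smul_comm] }
  refine finiteDimensional_of_local_holomorphic (D : Set X) (chartNhd D n E) isOpen_chartNhd hUp
    (fun p x hx => hx.1.1)
    (fun p x hx hD => eq_of_mem_chartNhd hx hD) F (fun p Φ => ?_) (fun p q x hxp hxq hxD => ?_) (fun Φ hΦ => ?_)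
  · obtain ⟨G, hG, hGF⟩ := exists_contMDiffAt_higgsCoord Φ.2 p
    refine ⟨fun z => G ((chartAt ℂ p).symm z), ?_, fun x hx hxD => ?_⟩
    · rintro _ ⟨x, hx, rfl⟩
      have h1 : ContMDiffAt 𝓘(ℂ) 𝓘(ℂ, (Fin n → ℂ) →L[ℂ] (Fin n → ℂ)) ω
          (fun z => G ((chartAt ℂ p).symm z)) (chartAt ℂ p x) := by
        refine ContMDiffAt.comp (chartAt ℂ p x) ?_ (contMDiffAt_chartAt_symm hx.1.1)
        rw [(chartAt ℂ p).left_inv hx.1.1]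
        exact hG x hx
      exact ((contMDiffAt_iff_contDiffAt.1 h1).differentiableAt (by simp)).differentiableWithinAt
    · simp only [(chartAt ℂ p).left_inv hx.1.1]
      exact hGF x hx hxD
  -- `φ` bounds the norm of the change of representative; by continuity it stays below its value at
  -- `x` plus one nearby.
  · let φ : X → ℝ := fun y => ‖poleFactor D p y * transitionDeriv p q y / poleFactor D q y‖ *
      (‖trivChange n E q p y‖ * ‖trivChange n E p q y‖)
    have hc : ContinuousAt φ x :=
      (((contMDiffAt_poleFactor hxp.1.1).continuousAt.mul
        (contMDiffAt_transitionDeriv hxp.1.1 hxq.1.1).continuousAt).div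
        (contMDiffAt_poleFactor hxq.1.1).continuousAt
        (poleFactor_ne_zero hxq.1.1 hxD)).norm.mul
        ((contMDiffAt_trivChange hxq.1.2 hxp.1.2).continuousAt.norm.mul
          (contMDiffAt_trivChange hxp.1.2 hxq.1.2).continuousAt.norm)
    refine ⟨φ x + 1, ?_⟩
    filter_upwards [hc.eventually (gt_mem_nhds (lt_add_one _)), eventually_notMem_of_notMem hxD,
      (isOpen_chartNhd p).mem_nhds hxp, (isOpen_chartNhd q).mem_nhds hxq] with y hy hyD hyp hyq Φ
    change ‖higgsCoord D n p Φ.1 y‖ ≤ _ * ‖higgsCoord D n q Φ.1 y‖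
    rw [higgsCoord_change hyp.1.1 hyp.1.2 hyq.1.1 hyq.1.2 hyD, norm_smul]
    refine le_trans ?_ (mul_le_mul_of_nonneg_right hy.le (norm_nonneg _))
    simp only [φ]
    rw [mul_assoc]
    refine mul_le_mul_of_nonneg_left ?_ (norm_nonneg _)
    calc _ ≤ ‖trivChange n E q p y‖ * (‖higgsCoord D n q Φ.1 y‖ * ‖trivChange n E p q y‖) :=
          (ContinuousLinearMap.opNorm_comp_le _ _).trans
            (mul_le_mul_of_nonneg_left (ContinuousLinearMap.opNorm_comp_le _ _) (norm_nonneg _))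
      _ = _ := by ring
  · apply Subtype.ext
    funext x
    by_cases hx : x ∈ D
    · exact Φ.2.1 x hx
    · have h1 : higgsCoord D n x Φ.1 x = 0 := hΦ x x (hUp x) hx
      have h2 := endCoord_injective (FiberBundle.mem_baseSet_trivializationAt' x)
        ((smul_eq_zero.1 h1).resolve_left (div_ne_zero
          (poleFactor_ne_zero (mem_chart_source ℂ x) hx)
          (dcoordAt_unitVector_ne_zero (mem_chart_source ℂ x))))
      refine LinearMap.ext fun v => ?_
      obtain ⟨c, rfl⟩ := eq_smul_unitVector v
      rw [map_smul, h2]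
      simp

end HiggsFields

/-! ### The Hitchin map -/

section

variable {X : Type*} [TopologicalSpace X] [ChartedSpace ℂ X] {D : Finset X} {m : ℕ}
  {E : X → Type*}
  [∀ x, AddCommGroup (E x)] [∀ x, Module ℂ (E x)] [∀ x, TopologicalSpace (E x)]
  [∀ x, IsTopologicalAddGroup (E x)] [∀ x, ContinuousSMul ℂ (E x)]
  [TopologicalSpace (TotalSpace (Fin (2 * m) → ℂ) E)] [FiberBundle (Fin (2 * m) → ℂ) E]
  [VectorBundle ℂ (Fin (2 * m) → ℂ) E]
  {L : X → Type*}
  [∀ x, AddCommGroup (L x)] [∀ x, Module ℂ (L x)] [∀ x, TopologicalSpace (L x)]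
  [∀ x, IsTopologicalAddGroup (L x)] [∀ x, ContinuousSMul ℂ (L x)]
  [TopologicalSpace (TotalSpace ℂ L)] [FiberBundle ℂ L] [VectorBundle ℂ ℂ L]

theorem hitchinMap_eq_zero_of_isNilpotentField {B : SymplecticParabolic D (2 * m) E L}
    {Φ : B.higgsFields} (hΦ : SymplecticParabolic.IsNilpotentField Φ.1) : B.hitchinMap Φ = 0 := by
  funext i
  apply Subtype.ext
  funext x v
  have := i.2
  exact charCoeff_eq_zero_of_isNilpotent (hΦ x v) (by omega) (by omega)

/-- All multiples of a nonzero nilpotent field are distinct points of the fibre over 0. -/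
theorem isVeryStable_of_isQuasiFinite {B : SymplecticParabolic D (2 * m) E L}
    (h : IsQuasiFinite B.hitchinMap) : B.IsVeryStable := by
  intro Φ hΦ hnil
  by_contra hne
  let Φ' : B.higgsFields := ⟨Φ, hΦ⟩
  have hne' : Φ' ≠ 0 := fun h0 => hne (congrArg Subtype.val h0)
  refine (Set.infinite_range_of_injective (smul_left_injective ℂ hne')) ((h 0).subset ?_)
  rintro _ ⟨c, rfl⟩
  exact hitchinMap_eq_zero_of_isNilpotentField fun x v => (hnil x v).smul c

/-- Even coefficients vanish by hypothesis, odd ones by skewness. Nondegeneracy of the form is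
available only off `D`; on `D` the field is 0 by convention. -/
theorem isNilpotentField_of_hitchinMap_eq_zero {B : SymplecticParabolic D (2 * m) E L}
    {Φ : B.higgsFields} (hΦ : B.hitchinMap Φ = 0) :
    SymplecticParabolic.IsNilpotentField Φ.1 := by
  intro x v
  by_cases hx : x ∈ D
  · rw [Φ.2.1 x hx]
    exact IsNilpotent.zero
  refine isNilpotent_of_charCoeff_eq_zero (n := 2 * m) fun j h0 hj => ?_
  rcases Nat.even_or_odd' j with ⟨k, rfl | rfl⟩
  -- The components of the Hitchin map are indexed from 0, so s_{2k} is the one of index k - 1; here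
  -- k > 0.
  · have h1 := congrFun (congrFun (congrArg Subtype.val
      (congrFun hΦ ⟨k - 1, by omega⟩)) x) v
    have h2 : 2 * (k - 1 + 1) = 2 * k := by omega
    simp only [SymplecticParabolic.hitchinMap, h2] at h1
    exact h1
  · let eL : L x ≃ₗ[ℂ] ℂ := ((trivializationAt ℂ L x).continuousLinearEquivAt ℂ x
      (FiberBundle.mem_baseSet_trivializationAt' x)).toLinearEquiv
    let β : E x →ₗ[ℂ] E x →ₗ[ℂ] L x := LinearMap.mk₂ ℂ (fun u w => B.form x u w)
      (by simp) (by simp) (by simp) (by simp)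
    exact charCoeff_eq_zero_of_odd_of_skew eL β (B.form_nondegenerate x hx)
      (Φ.2.2.2.2 x v) hj ⟨k, rfl⟩

/-- For a matrix depending linearly on `v`, the coefficients of the characteristic polynomial are
homogeneous polynomials in the coordinates of `v`. -/
theorem exists_isHomogeneous_charpoly_coeff {V : Type*} [AddCommMonoid V] [Module ℂ V] {d n : ℕ}
    (b : Module.Basis (Fin d) ℂ V) (N : V →ₗ[ℂ] Matrix (Fin n) (Fin n) ℂ) {j : ℕ} (hj : j ≤ n) :
    ∃ q : MvPolynomial (Fin d) ℂ, q.IsHomogeneous j ∧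
      ∀ v, (N v).charpoly.coeff (n - j) = MvPolynomial.eval (b.repr v) q := by
  -- Substitute the matrix entries, which are linear forms in the coordinates of `v`, into the
  -- coefficient of the generic characteristic polynomial, homogeneous of degree `j`.
  refine ⟨MvPolynomial.aeval (fun ij : Fin n × Fin n =>
    ∑ i, MvPolynomial.C (N (b i) ij.1 ij.2) * MvPolynomial.X i)
      ((Matrix.charpoly.univ ℂ (Fin n)).coeff (n - j)), ?_, fun v => ?_⟩
  · have h := Matrix.charpoly.univ_coeff_isHomogeneous ℂ (Fin n) (n - j) j (by simp; omega)
    have hlin : ∀ ij : Fin n × Fin n, (∑ i, MvPolynomial.C (N (b i) ij.1 ij.2) *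
        MvPolynomial.X i : MvPolynomial (Fin d) ℂ).IsHomogeneous 1 := fun ij =>
      MvPolynomial.IsHomogeneous.sum _ _ _ fun i _ => by
        simpa using (MvPolynomial.isHomogeneous_C (Fin d) (N (b i) ij.1 ij.2)).mul
          (MvPolynomial.isHomogeneous_X ℂ i)
    have h2 := h.aeval _ hlin
    rwa [one_mul] at h2
  · have key : (N v).charpoly.coeff (n - j) =
        MvPolynomial.aeval (fun ij : Fin n × Fin n => N v ij.1 ij.2)
          ((Matrix.charpoly.univ ℂ (Fin n)).coeff (n - j)) :=
      (Matrix.charpoly.univ_coeff_eval₂Hom (Fin n) (RingHom.id ℂ)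
        (fun ij => N v ij.1 ij.2) (n - j)).symm
    have h2 : (fun ij : Fin n × Fin n => N v ij.1 ij.2) = fun ij =>
        MvPolynomial.aeval (b.repr v : Fin d → ℂ)
          (∑ i, MvPolynomial.C (N (b i) ij.1 ij.2) * MvPolynomial.X i) := by
      funext ij
      have h1 := congrArg (fun A => A ij.1 ij.2) (congrArg N (b.sum_repr v))
      rw [map_sum] at h1
      simp only [map_smul, Matrix.sum_apply, Matrix.smul_apply, smul_eq_mul] at h1
      simp [← h1, mul_comm]
    rw [key, h2, ← MvPolynomial.comp_aeval_apply, MvPolynomial.aeval_eq_eval]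

/-- In coordinates on the space of Higgs fields, the values of `s_j` are homogeneous polynomials
of degree `j`. -/
theorem exists_isHomogeneous_charCoeff (B : SymplecticParabolic D (2 * m) E L) {d : ℕ}
    (b : Module.Basis (Fin d) ℂ B.higgsFields) {j : ℕ} (hj : j ≤ 2 * m) (x : X)
    (v : TangentSpace 𝓘(ℂ) x) : ∃ q : MvPolynomial (Fin d) ℂ, q.IsHomogeneous j ∧
      ∀ Φ : B.higgsFields, charCoeff (2 * m) j (Φ.1 x v) = MvPolynomial.eval (b.repr Φ) q := by
  let e := ((trivializationAt (Fin (2 * m) → ℂ) E x).continuousLinearEquivAt ℂ x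
    (FiberBundle.mem_baseSet_trivializationAt' x)).toLinearEquiv
  let N : B.higgsFields →ₗ[ℂ] Matrix (Fin (2 * m)) (Fin (2 * m)) ℂ :=
    { toFun := fun Φ => LinearMap.toMatrix (Pi.basisFun ℂ (Fin (2 * m)))
        (Pi.basisFun ℂ (Fin (2 * m))) (e.conj (Φ.1 x v : E x →ₗ[ℂ] E x))
      map_add' := fun Φ Φ' => by simp
      map_smul' := fun c Φ => by simp }
  obtain ⟨q, hq, h⟩ := exists_isHomogeneous_charpoly_coeff (V := B.higgsFields) b N hj
  exact ⟨q, hq, fun Φ => (charCoeff_eq j e _).trans (h Φ)⟩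

/-- Functions on the tangent spaces as functions on the total space of the tangent bundle. -/
def uncurryDifferential : (∀ x : X, TangentSpace 𝓘(ℂ) x → ℂ) →ₗ[ℂ]
    ((Σ x : X, TangentSpace 𝓘(ℂ) x) → ℂ) where
  toFun q y := q y.1 y.2
  map_add' _ _ := rfl
  map_smul' _ _ := rfl

/-- A differential is determined by its values on tangent vectors, and those values are homogeneous
in `Φ`; duality extends this to arbitrary linear forms. -/
theorem exists_isHomogeneous_hitchinMap (B : SymplecticParabolic D (2 * m) E L) {d : ℕ}
    (b : Module.Basis (Fin d) ℂ B.higgsFields) (i : Fin m)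
    (l : Module.Dual ℂ (logDifferentials X D (2 * ((i : ℕ) + 1)))) :
    ∃ q : MvPolynomial (Fin d) ℂ, q.IsHomogeneous (2 * ((i : ℕ) + 1)) ∧
      ∀ Φ : B.higgsFields, l (B.hitchinMap Φ i) = MvPolynomial.eval (b.repr Φ) q := by
  have hj : 2 * ((i : ℕ) + 1) ≤ 2 * m := Nat.mul_le_mul_left 2 i.2
  obtain ⟨ε, hε⟩ : ∃ ε : logDifferentials X D (2 * ((i : ℕ) + 1)) →ₗ[ℂ]
      ((Σ x : X, TangentSpace 𝓘(ℂ) x) → ℂ), ∀ q y, ε q y = q.1 y.1 y.2 :=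
    ⟨uncurryDifferential ∘ₗ (logDifferentials X D (2 * ((i : ℕ) + 1))).subtype, fun _ _ => rfl⟩
  have hinj : Function.Injective ε := fun q q' h => by
    apply Subtype.ext
    funext x v
    rw [← hε q ⟨x, v⟩, h, hε]
  have hq : ∀ y, ∃ q : MvPolynomial (Fin d) ℂ, q.IsHomogeneous (2 * ((i : ℕ) + 1)) ∧
      ∀ Φ : B.higgsFields, ε (B.hitchinMap Φ i) y = MvPolynomial.eval (b.repr Φ) q := by
    intro y
    obtain ⟨q, hq, h⟩ := exists_isHomogeneous_charCoeff B b hj y.1 y.2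
    exact ⟨q, hq, fun Φ => (hε _ y).trans (h Φ)⟩
  exact exists_isHomogeneous_comp_linear (V := B.higgsFields) b ε hinj
    (fun Φ => B.hitchinMap Φ i) _ hq l

theorem isFiniteMorphism_of_isVeryStable [T2Space X] [CompactSpace X] [IsManifold 𝓘(ℂ) ω X]
    [ContMDiffVectorBundle ω (Fin (2 * m) → ℂ) E 𝓘(ℂ)] {B : SymplecticParabolic D (2 * m) E L}
    (h : B.IsVeryStable) : IsFiniteMorphism B.hitchinMap := by
  have := finiteDimensional_higgsFields B
  have : Module.Free ℂ B.higgsFields := Module.Free.of_divisionRing ℂ B.higgsFields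
  let b := Module.finBasis ℂ B.higgsFields
  exact isFiniteMorphism_of_homogeneous (V := B.higgsFields)
    (A := fun i : Fin m => logDifferentials X D (2 * ((i : ℕ) + 1))) B.hitchinMap
    (fun i => 2 * ((i : ℕ) + 1)) (fun i => Nat.succ_pos _) b
    (fun i l => exists_isHomogeneous_hitchinMap B b i l)
    fun Φ hΦ => Subtype.ext (h _ Φ.2 (isNilpotentField_of_hitchinMap_eq_zero hΦ))

end

end ParabolicHiggs

end

theorem mainTheorem2
    {X : Type*} [TopologicalSpace X] [T2Space X] [CompactSpace X] [ConnectedSpace X]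
    [ChartedSpace ℂ X] [IsManifold 𝓘(ℂ) ω X]
    (hg : 2 ≤ ParabolicHiggs.genus X)
    (D : Finset X) (m : ℕ) (hm : 0 < m)
    (E : X → Type*) [∀ x, AddCommGroup (E x)] [∀ x, Module ℂ (E x)]
    [∀ x, TopologicalSpace (E x)] [∀ x, IsTopologicalAddGroup (E x)]
    [∀ x, ContinuousSMul ℂ (E x)] [TopologicalSpace (TotalSpace (Fin (2 * m) → ℂ) E)]
    [FiberBundle (Fin (2 * m) → ℂ) E] [VectorBundle ℂ (Fin (2 * m) → ℂ) E]
    [ContMDiffVectorBundle ω (Fin (2 * m) → ℂ) E 𝓘(ℂ)]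
    (L : X → Type*) [∀ x, AddCommGroup (L x)] [∀ x, Module ℂ (L x)]
    [∀ x, TopologicalSpace (L x)] [∀ x, IsTopologicalAddGroup (L x)]
    [∀ x, ContinuousSMul ℂ (L x)] [TopologicalSpace (TotalSpace ℂ L)]
    [FiberBundle ℂ L] [VectorBundle ℂ ℂ L] [ContMDiffVectorBundle ω ℂ L 𝓘(ℂ)]
    (B : ParabolicHiggs.SymplecticParabolic D (2 * m) E L) (hB : B.IsStable) :
    (ParabolicHiggs.IsQuasiFinite B.hitchinMap → B.IsVeryStable) ∧
      (B.IsVeryStable → ParabolicHiggs.IsFiniteMorphism B.hitchinMap) := by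
  exact ⟨ParabolicHiggs.isVeryStable_of_isQuasiFinite, ParabolicHiggs.isFiniteMorphism_of_isVeryStable⟩
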